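/- Let $a>0$, $m>0$, $S\in C^1([-a,a],\mathbb C)$, and put $f(x)=\exp\left(-\int_0^x (m+S(s))\,ds\right)$, so that $f(0)=1$, $f$ does not vanish and $f'/f=-(m+S)$. Let $h=f'(0)$, $q_1=f''/f$ and $q_2=2(f'/f)^2-q_1$; thus $\frac{d^2}{dx^2}-q_1=\left(\partial_x+\frac{f'}{f}\right)\left(\partial_x-\frac{f'}{f}\right)$ and $\frac{d^2}{dx^2}-q_2=\left(\partial_x-\frac{f'}{f}\right)\left(\partial_x+\frac{f'}{f}\right)$. For a continuous $q:[-a,a]\to\mathbb C$ let $H$ be the solution, continuously differentiable on $|u|+|v|\le a$, of the Goursat problem $$\frac{\partial^2 H}{\partial u\,\partial v}=q(u+v)H,\qquad H(u,0)=\frac12\int_0^u q(s)\,ds,\qquad H(0,v)=0,$$ let $K(x,t)=H\left(\frac{x+t}2,\frac{x-t}2\right)$, and for $\kappa\in\mathbb C$ let $$\mathbf K(x,t;\kappa)=\frac{\kappa}{2}+K(x,t)+\frac{\kappa}{2}\int_t^x\left(K(x,s)-K(x,-s)\right)ds,\qquad \mathbf T_{q;\kappa}u(x)=u(x)+\int_{-x}^x\mathbf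 K(x,t;\kappa)\,u(t)\,dt .$$ Put $\mathbf T_1=\mathbf T_{q_1;h}$ and $\mathbf T_2=\mathbf T_{q_2;-h}$. Then the Goursat problems for $q_1$ and $q_2$ are solvable, $\mathbf T_1$ and $\mathbf T_2$ are continuous linear bijections of $C[-a,a]$ (complex-valued functions, uniform norm) with continuous inverses, and for every $E\in\mathbb C$: 1. If $(u_1,u_2)$ is a solution on $[-a,a]$ of $u_1'=Eu_2$, $u_2'=-Eu_1$, then $(\psi_1,\psi_2)=(\mathbf T_1u_1,\mathbf T_2u_2)$ is a solution on $[-a,a]$ of the Dirac system $(\partial_x+m+S)\psi_1=E\psi_2$, $(-\partial_x+m+S)\psi_2=E\psi_1$, and $\psi_1(0)=u_1(0)$, $\psi_2(0)=u_2(0)$. 2. Conversely, if $(\psi_1,\psi_2)$ is a solution on $[-a,a]$ of the Dirac system, then $(u_1,u_2)=(\mathbf T_1^{-1}\psi_1,\mathbf T_2^{-1}\psi_2)$ is a solution on $[-a,a]$ of $u_1'=Eu_2$, $u_2'=-Eu_1$, and $u_1(0)=\psi_1(0)$, $u_2(0)=\psi_2(0)$. -/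

import Mathlib

open Set MeasureTheory

noncomputable section

namespace DiracTransmutation

/-- The square `|u| + |v| ≤ a` in characteristic variables `u = (x + t) / 2`, `v = (x - t) / 2`;
it corresponds to `|x| ≤ a`, `|t| ≤ a`. -/
def goursatDomain (a : ℝ) : Set (ℝ × ℝ) := {p | |p.1| + |p.2| ≤ a}

/-- `H` is a classical (`C¹` up to the boundary) solution on `|u| + |v| ≤ a` of the Goursat problem
`∂²H/∂u∂v = q(u + v) H`, `H(u, 0) = (1/2) ∫_0^u q`, `H(0, v) = 0`. -/
structure IsGoursatSolution (a : ℝ) (q : ℝ → ℂ) (H : ℝ × ℝ → ℂ) : Prop where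
  contDiffOn : ContDiffOn ℝ 1 H (goursatDomain a)
  mixed_deriv : ∀ u v : ℝ, |u| + |v| < a →
    HasDerivAt (fun s => deriv (fun r => H (s, r)) v) (q (u + v) * H (u, v)) u
  left : ∀ u ∈ Icc (-a) a, H (u, 0) = (1 / 2 : ℂ) * ∫ s in (0 : ℝ)..u, q s
  right : ∀ v ∈ Icc (-a) a, H (0, v) = 0

/-- The solution of the Goursat problem (its values on `|u| + |v| ≤ a` are the only ones used). -/
def goursatSolution (a : ℝ) (q : ℝ → ℂ) : ℝ × ℝ → ℂ :=
  Classical.epsilon (IsGoursatSolution a q)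

/-- The kernel `K(x, t) = H((x + t) / 2, (x - t) / 2)`. -/
def kernel (a : ℝ) (q : ℝ → ℂ) (x t : ℝ) : ℂ :=
  goursatSolution a q ((x + t) / 2, (x - t) / 2)

/-- The kernel `K(x, t; h) = h/2 + K(x, t) + (h/2) ∫_t^x (K(x, s) - K(x, -s)) ds`. -/
def kernelH (a : ℝ) (q : ℝ → ℂ) (h : ℂ) (x t : ℝ) : ℂ :=
  h / 2 + kernel a q x t +
    h / 2 * ∫ s in t..x, (kernel a q x s - kernel a q x (-s))

/-- The Volterra operator `T_h u(x) = u(x) + ∫_{-x}^{x} K(x, t; h) u(t) dt`. -/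
def transmutation (a : ℝ) (q : ℝ → ℂ) (h : ℂ) (u : ℝ → ℂ) (x : ℝ) : ℂ :=
  u x + ∫ t in (-x)..x, kernelH a q h x t * u t

/-- The potential `f'' / f` of the operator `d²/dx² - f''/f = (∂ + f'/f)(∂ - f'/f)`,
derivatives on `[-a, a]` being one-sided at the end points. -/
def potential (a : ℝ) (f : ℝ → ℂ) (x : ℝ) : ℂ :=
  derivWithin (derivWithin f (Icc (-a) a)) (Icc (-a) a) x / f x

/-- The Darboux transformed potential `2 (f'/f)² - f''/f`, that is, the potential of
`(∂ - f'/f)(∂ + f'/f)`. -/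
def darbouxPotential (a : ℝ) (f : ℝ → ℂ) (x : ℝ) : ℂ :=
  2 * (derivWithin f (Icc (-a) a) x / f x) ^ 2 - potential a f x

/-- `f(x) = exp(-∫_0^x (m + S(s)) ds)`. -/
def diracF (m : ℝ) (S : ℝ → ℂ) (x : ℝ) : ℂ :=
  Complex.exp (-∫ s in (0 : ℝ)..x, ((m : ℂ) + S s))

/-- `u₁' = E u₂`, `u₂' = -E u₁` on `[-a, a]`. -/
structure IsFreeSolution (a : ℝ) (E : ℂ) (u₁ u₂ : ℝ → ℂ) : Prop where
  diff₁ : DifferentiableOn ℝ u₁ (Icc (-a) a)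
  diff₂ : DifferentiableOn ℝ u₂ (Icc (-a) a)
  eq₁ : ∀ x ∈ Icc (-a) a, derivWithin u₁ (Icc (-a) a) x = E * u₂ x
  eq₂ : ∀ x ∈ Icc (-a) a, derivWithin u₂ (Icc (-a) a) x = -E * u₁ x

/-- `(∂ + m + S) ψ₁ = E ψ₂`, `(-∂ + m + S) ψ₂ = E ψ₁` on `[-a, a]`. -/
structure IsDiracSolution (a m : ℝ) (S : ℝ → ℂ) (E : ℂ) (ψ₁ ψ₂ : ℝ → ℂ) : Prop where
  diff₁ : DifferentiableOn ℝ ψ₁ (Icc (-a) a)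
  diff₂ : DifferentiableOn ℝ ψ₂ (Icc (-a) a)
  eq₁ : ∀ x ∈ Icc (-a) a,
    derivWithin ψ₁ (Icc (-a) a) x + ((m : ℂ) + S x) * ψ₁ x = E * ψ₂ x
  eq₂ : ∀ x ∈ Icc (-a) a,
    -derivWithin ψ₂ (Icc (-a) a) x + ((m : ℂ) + S x) * ψ₂ x = E * ψ₁ x

/-- A function in `C[-a, a]` viewed as a function on the line; only its values on `[-a, a]`
matter. -/
def toLine {a : ℝ} (ha : 0 < a) (u : C(Icc (-a) a, ℂ)) : ℝ → ℂ :=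
  IccExtend (neg_le_self ha.le) u

end DiracTransmutation

end

/-! Write p = f'/f = -(m + S). Then q₁ = p' + p², and q₂ is the same expression for -p, so p ↦ -p
exchanges the two rows of the Dirac system.

The core is a pair of kernels A, B whose operators u ↦ u + ∫_{-x}^x A u dt and its analogue for B
satisfy (∂ - p) T_A = T_B ∂ and (∂ + p) T_B = T_A ∂. Applied to a free solution these are the Dirac
equations (`hasDerivAt_volterra`). By integration by parts they amount to A_x + B_t = pA and B_x +
A_t = -pB, with A - B = p on t = x and A + B = 0 on t = -x. In characteristic variables this reads
∂_u(A + B) = p(A - B), ∂_v(A - B) = p(A + B). Setting A + B = Sp + Sm and A - B = (Sp - Sm) ∘ swap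
decouples it into ∂_u Sp(u, v) = p(u + v) Sp(v, u), Sp(0, v) = p(v)/2, and the same problem for Sm
with -p. Each is a Volterra equation, solved by contraction.

It remains to see that A is the prescribed kernel (`goursatSolution_spec`). A solves the wave
equation for p' + p², but equals h/2 on u = 0, where h = p(0). Subtracting (h/2) R, with R the wave
equal to 1 on both characteristics, gives the Goursat solution K by uniqueness. Moreover ∫_t^x (K(x,
s) - K(x, -s)) ds = R - 1, so the terms added to K in the definition of the kernel restore A.

The operators are invertible since high powers of their integral parts have small norm
(`exists_volterra_equiv`). The converse needs no inverse kernel: Dirac solutions are determined by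
their values at 0 (`IsDiracSolution.unique`), the operators preserve these values, and free
solutions exist with any values at 0. -/

namespace DiracTransmutation

/-! ### C¹ functions of two variables, given by explicit partial derivatives. -/

/-- `g₁`, `g₂` are the partial derivatives of `g`, and all three functions are continuous. -/
structure HasPartials (g g₁ g₂ : ℝ × ℝ → ℂ) : Prop where
  cont : Continuous g
  cont₁ : Continuous g₁
  cont₂ : Continuous g₂
  deriv₁ : ∀ u v, HasDerivAt (fun s => g (s, v)) (g₁ (u, v)) u
  deriv₂ : ∀ u v, HasDerivAt (fun s => g (u, s)) (g₂ (u, v)) v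

namespace HasPartials

variable {g g₁ g₂ k k₁ k₂ : ℝ × ℝ → ℂ}

theorem hasStrictFDerivAt (h : HasPartials g g₁ g₂) (z : ℝ × ℝ) :
    HasStrictFDerivAt g ((ContinuousLinearMap.toSpanSingleton ℝ (g₁ z)).coprod
      (ContinuousLinearMap.toSpanSingleton ℝ (g₂ z))) z := by
  have := hasStrictFDerivAt_uncurry_coprod (𝕜 := ℝ) (u := z) (f := fun u v => g (u, v))
    (f₁ := fun u v => ContinuousLinearMap.toSpanSingleton ℝ (g₁ (u, v)))
    (f₂ := fun u v => ContinuousLinearMap.toSpanSingleton ℝ (g₂ (u, v)))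
    (Filter.Eventually.of_forall fun w => (h.deriv₁ w.1 w.2).hasFDerivAt)
    (Filter.Eventually.of_forall fun w => (h.deriv₂ w.1 w.2).hasFDerivAt)
    (((ContinuousLinearMap.toSpanSingletonCLE (𝕜 := ℝ) (E := ℂ)).continuous.comp
      h.cont₁).continuousAt)
    (((ContinuousLinearMap.toSpanSingletonCLE (𝕜 := ℝ) (E := ℂ)).continuous.comp
      h.cont₂).continuousAt)
  exact this

theorem contDiff (h : HasPartials g g₁ g₂) : ContDiff ℝ 1 g := by
  rw [contDiff_one_iff_hasFDerivAt]
  refine ⟨fun z => (ContinuousLinearMap.toSpanSingleton ℝ (g₁ z)).coprod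
      (ContinuousLinearMap.toSpanSingleton ℝ (g₂ z)), ?_, fun z => (h.hasStrictFDerivAt z).hasFDerivAt⟩
  have h1 := (ContinuousLinearMap.toSpanSingletonCLE (𝕜 := ℝ) (E := ℂ)).continuous.comp h.cont₁
  have h2 := (ContinuousLinearMap.toSpanSingletonCLE (𝕜 := ℝ) (E := ℂ)).continuous.comp h.cont₂
  exact (ContinuousLinearMap.coprodEquivL ℝ).continuous.comp (h1.prodMk h2)

theorem comp_curve (h : HasPartials g g₁ g₂) {α β : ℝ → ℝ} {α' β' x : ℝ}
    (hα : HasDerivAt α α' x) (hβ : HasDerivAt β β' x) :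
    HasDerivAt (fun y => g (α y, β y)) (α' * g₁ (α x, β x) + β' * g₂ (α x, β x)) x := by
  have := (h.hasStrictFDerivAt (α x, β x)).hasFDerivAt.comp_hasDerivAt x (hα.prodMk hβ)
  simpa using! this

theorem add (h : HasPartials g g₁ g₂) (h' : HasPartials k k₁ k₂) :
    HasPartials (fun z => g z + k z) (fun z => g₁ z + k₁ z) (fun z => g₂ z + k₂ z) :=
  ⟨h.cont.add h'.cont, h.cont₁.add h'.cont₁, h.cont₂.add h'.cont₂,
    fun u v => (h.deriv₁ u v).add (h'.deriv₁ u v), fun u v => (h.deriv₂ u v).add (h'.deriv₂ u v)⟩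

theorem const_mul (h : HasPartials g g₁ g₂) (c : ℂ) :
    HasPartials (fun z => c * g z) (fun z => c * g₁ z) (fun z => c * g₂ z) :=
  ⟨h.cont.const_mul c, h.cont₁.const_mul c, h.cont₂.const_mul c,
    fun u v => (h.deriv₁ u v).const_mul c, fun u v => (h.deriv₂ u v).const_mul c⟩

theorem sub (h : HasPartials g g₁ g₂) (h' : HasPartials k k₁ k₂) :
    HasPartials (fun z => g z - k z) (fun z => g₁ z - k₁ z) (fun z => g₂ z - k₂ z) :=
  ⟨h.cont.sub h'.cont, h.cont₁.sub h'.cont₁, h.cont₂.sub h'.cont₂,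
    fun u v => (h.deriv₁ u v).sub (h'.deriv₁ u v), fun u v => (h.deriv₂ u v).sub (h'.deriv₂ u v)⟩

theorem swap (h : HasPartials g g₁ g₂) :
    HasPartials (fun z => g z.swap) (fun z => g₂ z.swap) (fun z => g₁ z.swap) :=
  ⟨h.cont.comp continuous_swap, h.cont₂.comp continuous_swap, h.cont₁.comp continuous_swap,
    fun u v => h.deriv₂ v u, fun u v => h.deriv₁ v u⟩

end HasPartials

/-! ### Integrals depending on a parameter. -/

theorem hasDerivAt_parametric_integral {g g' : ℝ × ℝ → ℂ} (hg : Continuous g)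
    (hg' : Continuous g') (h : ∀ s v, HasDerivAt (fun r => g (s, r)) (g' (s, v)) v) (a b v : ℝ) :
    HasDerivAt (fun r => ∫ s in a..b, g (s, r)) (∫ s in a..b, g' (s, v)) v := by
  obtain ⟨M, hM⟩ := ((isCompact_uIcc (a := a) (b := b)).prod
    (isCompact_closedBall v 1)).exists_bound_of_continuousOn hg'.continuousOn
  refine (intervalIntegral.hasDerivAt_integral_of_dominated_loc_of_deriv_le
    (F := fun r s => g (s, r)) (F' := fun r s => g' (s, r)) (bound := fun _ => M)
    (Metric.closedBall_mem_nhds v one_pos) ?_ ?_ ?_ ?_ ?_ ?_).2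
  · exact Filter.Eventually.of_forall fun r =>
      (by fun_prop : Continuous fun s => g (s, r)).aestronglyMeasurable
  · exact (by fun_prop : Continuous fun s => g (s, v)).intervalIntegrable _ _
  · exact (by fun_prop : Continuous fun s => g' (s, v)).aestronglyMeasurable
  · exact Filter.Eventually.of_forall fun s hs r hr => hM (s, r) ⟨uIoc_subset_uIcc hs, hr⟩
  · exact intervalIntegrable_const
  · exact Filter.Eventually.of_forall fun s _ r _ => h s r

theorem continuous_primitive_fst {g : ℝ × ℝ → ℂ} (hg : Continuous g) :
    Continuous fun z : ℝ × ℝ => ∫ s in (0 : ℝ)..z.1, g (s, z.2) :=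
  intervalIntegral.continuous_parametric_intervalIntegral_of_continuous
    (f := fun (z : ℝ × ℝ) s => g (s, z.2)) (by fun_prop) continuous_fst

theorem hasPartials_primitive {g g' : ℝ × ℝ → ℂ} (hg : Continuous g)
    (hg' : Continuous g') (h : ∀ s v, HasDerivAt (fun r => g (s, r)) (g' (s, v)) v) :
    HasPartials (fun z => ∫ s in (0 : ℝ)..z.1, g (s, z.2)) g
      (fun z => ∫ s in (0 : ℝ)..z.1, g' (s, z.2)) where
  cont := continuous_primitive_fst hg
  cont₁ := hg
  cont₂ := continuous_primitive_fst hg'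
  deriv₁ u v := by
    have hc : Continuous fun s => g (s, v) := by fun_prop
    exact intervalIntegral.integral_hasDerivAt_right (hc.intervalIntegrable _ _)
      (hc.stronglyMeasurableAtFilter _ _) hc.continuousAt
  deriv₂ u v := hasDerivAt_parametric_integral hg hg' h 0 u v

/-- The integral is P(y, y) - P(-y, y) for the C¹ primitive P(u, v) = ∫_0^u g(s, v) ds, so the chain
rule along the two lines gives the Leibniz formula. -/
theorem hasDerivAt_integral_symmetric {g g' : ℝ × ℝ → ℂ} (hg : Continuous g)
    (hg' : Continuous g') (h : ∀ s v, HasDerivAt (fun r => g (s, r)) (g' (s, v)) v) (x : ℝ) :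
    HasDerivAt (fun y => ∫ t in (-y)..y, g (t, y))
      (g (x, x) + g (-x, x) + ∫ t in (-x)..x, g' (t, x)) x := by
  have hp := hasPartials_primitive hg hg' h
  have h1 := (hp.comp_curve (hasDerivAt_id x) (hasDerivAt_id x)).sub
    (hp.comp_curve (hasDerivAt_neg x) (hasDerivAt_id x))
  have hi (k : ℝ × ℝ → ℂ) (hk : Continuous k) (y : ℝ) :
      (∫ t in (0 : ℝ)..y, k (t, y)) - (∫ t in (0 : ℝ)..(-y), k (t, y)) =
        ∫ t in (-y)..y, k (t, y) :=
    intervalIntegral.integral_interval_sub_left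
      ((by fun_prop : Continuous fun t => k (t, y)).intervalIntegrable _ _)
      ((by fun_prop : Continuous fun t => k (t, y)).intervalIntegrable _ _)
  convert! h1 using 1
  · funext y
    exact (hi g hg y).symm
  · rw [← hi g' hg' x]
    simp only [id]
    push_cast
    ring

/-! ### Weighted Volterra estimates and the swap equation. -/

section

/-- Integration against the weight exp(l|s|) gains a factor 1/l. This one estimate makes every
Volterra term below contractive, whatever the size of the domain. -/
theorem norm_integral_le_exp {g : ℝ → ℂ} {M l : ℝ} (hl : 0 < l) (hM : 0 ≤ M) (u : ℝ)
    (hg : ∀ s ∈ uIcc 0 u, ‖g s‖ ≤ M * Real.exp (l * |s|)) :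
    ‖∫ s in (0 : ℝ)..u, g s‖ ≤ M / l * Real.exp (l * |u|) := by
  have key : ∀ x : ℝ, 0 ≤ x → ∫ s in (0 : ℝ)..x, M * Real.exp (l * |s|) =
      M / l * (Real.exp (l * x) - 1) := by
    intro x hx
    have : ∀ s ∈ uIcc 0 x, HasDerivAt (fun s => M / l * Real.exp (l * s))
        (M * Real.exp (l * s)) s := by
      intro s _
      have := (((hasDerivAt_id s).const_mul l).exp).const_mul (M / l)
      convert! this using 1
      simp only [id]
      field_simp
    rw [intervalIntegral.integral_congr (g := fun s => M * Real.exp (l * s)),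
      intervalIntegral.integral_eq_sub_of_hasDerivAt this
        ((by fun_prop : Continuous fun s => M * Real.exp (l * s)).intervalIntegrable _ _)]
    · simp; ring
    · intro s hs
      rw [uIcc_of_le hx] at hs
      simp [abs_of_nonneg hs.1]
  have hab : |∫ s in (0 : ℝ)..u, M * Real.exp (l * |s|)| = M / l * (Real.exp (l * |u|) - 1) := by
    have h0 : 0 ≤ M / l * (Real.exp (l * |u|) - 1) :=
      mul_nonneg (div_nonneg hM hl.le) (sub_nonneg.2 (Real.one_le_exp (by positivity)))
    rcases le_total 0 u with hu | hu
    · rw [key u hu, abs_of_nonneg hu, abs_of_nonneg]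
      rwa [abs_of_nonneg hu] at h0
    · have := intervalIntegral.integral_comp_neg (a := 0) (b := -u)
        (fun s => M * Real.exp (l * |s|))
      simp only [abs_neg, neg_neg, neg_zero] at this
      rw [key (-u) (by linarith)] at this
      rw [intervalIntegral.integral_symm, ← this, abs_neg, abs_of_nonpos hu, abs_of_nonneg]
      rwa [abs_of_nonpos hu] at h0
  have hc : Continuous fun s : ℝ => M * Real.exp (l * |s|) := by fun_prop
  calc ‖∫ s in (0 : ℝ)..u, g s‖ ≤ |∫ s in (0 : ℝ)..u, M * Real.exp (l * |s|)| :=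
        intervalIntegral.norm_integral_le_abs_of_norm_le
          ((ae_restrict_iff' measurableSet_uIoc).2 (Filter.Eventually.of_forall fun s hs =>
            hg s (uIoc_subset_uIcc hs))) (hc.intervalIntegrable _ _)
    _ = M / l * (Real.exp (l * |u|) - 1) := hab
    _ ≤ _ := mul_le_mul_of_nonneg_left (by linarith) (div_nonneg hM hl.le)

/-- Uniqueness for a coupled pair of Volterra inequalities on the square `|u| + |v| ≤ ρ`. -/
theorem eq_zero_of_volterra_pair {ρ C : ℝ} (hρ : 0 ≤ ρ) (hC : 0 < C) {α β : ℝ × ℝ → ℂ}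
    {A B : ℝ × ℝ → ℂ}
    (hα : ContinuousOn α (goursatDomain ρ)) (hβ : ContinuousOn β (goursatDomain ρ))
    (hA : ∀ z ∈ goursatDomain ρ, ‖A z‖ ≤ C) (hB : ∀ z ∈ goursatDomain ρ, ‖B z‖ ≤ C)
    (h1 : ∀ u v, (u, v) ∈ goursatDomain ρ → α (u, v) = ∫ s in (0 : ℝ)..u, A (s, v) * β (s, v))
    (h2 : ∀ u v, (u, v) ∈ goursatDomain ρ → β (u, v) = ∫ r in (0 : ℝ)..v, B (u, r) * α (u, r)) :
    ∀ z ∈ goursatDomain ρ, α z = 0 ∧ β z = 0 := by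
  have hcomp : IsCompact (goursatDomain ρ) := by
    refine (isCompact_Icc.prod isCompact_Icc : IsCompact (Icc (-ρ) ρ ×ˢ Icc (-ρ) ρ)).of_isClosed_subset
      (isClosed_le (by fun_prop) continuous_const) ?_
    rintro ⟨u, v⟩ (h : |u| + |v| ≤ ρ)
    exact ⟨abs_le.1 (by have := abs_nonneg v; linarith), abs_le.1 (by have := abs_nonneg u; linarith)⟩
  have hne : (goursatDomain ρ).Nonempty := ⟨(0, 0), by simpa [goursatDomain] using hρ⟩
  set w : ℝ × ℝ → ℝ := fun z => Real.exp (2 * C * (|z.1| + |z.2|)) with hw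
  have hwc : Continuous w := by fun_prop
  have hwp : ∀ z, 0 < w z := fun z => Real.exp_pos _
  obtain ⟨z₀, hz₀, hmax⟩ := hcomp.exists_isMaxOn hne
    (f := fun z => max ‖α z‖ ‖β z‖ / w z)
    ((hα.norm.sup hβ.norm).div hwc.continuousOn fun z _ => (hwp z).ne')
  -- The maximal weighted size m will satisfy m ≤ m/2: a coefficient of size C against rate 2C costs
  -- C/(2C).
  set m := max ‖α z₀‖ ‖β z₀‖ / w z₀ with hm
  have hm0 : 0 ≤ m := div_nonneg (le_max_of_le_left (norm_nonneg _)) (hwp _).le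
  have hbd : ∀ z ∈ goursatDomain ρ, max ‖α z‖ ‖β z‖ ≤ m * w z := fun z hz =>
    (div_le_iff₀ (hwp z)).1 (hmax hz)
  have habs : ∀ {s u : ℝ}, s ∈ uIcc 0 u → |s| ≤ |u| := by
    intro s u hs
    rcases le_total 0 u with hu | hu
    · rw [uIcc_of_le hu] at hs
      rw [abs_of_nonneg hu, abs_of_nonneg hs.1]; exact hs.2
    · rw [uIcc_of_ge hu] at hs
      rw [abs_of_nonpos hu, abs_of_nonpos hs.2]; linarith [hs.1]
  have e1 : ∀ z ∈ goursatDomain ρ, ‖α z‖ ≤ m / 2 * w z := by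
    rintro ⟨u, v⟩ hz
    rw [h1 u v hz]
    refine (norm_integral_le_exp (M := C * m * Real.exp (2 * C * |v|)) (l := 2 * C) (by positivity)
      (by positivity) u ?_).trans (le_of_eq ?_)
    · intro s hs
      have hs' : (s, v) ∈ goursatDomain ρ :=
        (add_le_add_left (habs hs) |v|).trans hz
      rw [norm_mul]
      calc _ ≤ C * (m * w (s, v)) := mul_le_mul (hA _ hs')
            ((le_max_right _ _).trans (hbd _ hs')) (norm_nonneg _) hC.le
        _ = _ := by simp only [hw, mul_add, Real.exp_add]; ring
    · simp only [hw, mul_add, Real.exp_add]; field_simp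
  have e2 : ∀ z ∈ goursatDomain ρ, ‖β z‖ ≤ m / 2 * w z := by
    rintro ⟨u, v⟩ hz
    rw [h2 u v hz]
    refine (norm_integral_le_exp (M := C * m * Real.exp (2 * C * |u|)) (l := 2 * C) (by positivity)
      (by positivity) v ?_).trans (le_of_eq ?_)
    · intro s hs
      have hs' : (u, s) ∈ goursatDomain ρ :=
        (add_le_add_right (habs hs) |u|).trans hz
      rw [norm_mul]
      calc _ ≤ C * (m * w (u, s)) := mul_le_mul (hB _ hs')
            ((le_max_left _ _).trans (hbd _ hs')) (norm_nonneg _) hC.le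
        _ = _ := by simp only [hw, mul_add, Real.exp_add]; ring
    · simp only [hw, mul_add, Real.exp_add]; field_simp
  have hm' : m ≤ m / 2 := by
    rw [hm, div_le_iff₀ (hwp z₀)]
    exact max_le (e1 z₀ hz₀) (e2 z₀ hz₀)
  have hmz : m = 0 := by linarith
  intro z hz
  have := hbd z hz
  rw [hmz, zero_mul] at this
  exact ⟨norm_le_zero_iff.1 ((le_max_left _ _).trans this),
    norm_le_zero_iff.1 ((le_max_right _ _).trans this)⟩

/-- `N` solves `N(u, v) = φ(v) + ∫_0^u p(s + v) N(v, s) ds`, that is,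
`∂N/∂u = p(u + v) N(v, u)` and `N(0, v) = φ(v)`. -/
structure IsSwapSolution (p φ : ℝ → ℂ) (N : ℝ × ℝ → ℂ) : Prop where
  cont : Continuous N
  eq : ∀ u v, N (u, v) = φ v + ∫ s in (0 : ℝ)..u, p (s + v) * N (v, s)

/-- Fixed point for N/w among bounded continuous functions on the plane. The weight w is symmetric
in its two variables, so the swap respects it, and the rate 2C gives contraction constant 1/2. Data
growing no faster than the weight are allowed. -/
theorem exists_isSwapSolution {p φ : ℝ → ℂ} (hp : Continuous p) (hφ : Continuous φ) {C c : ℝ}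
    (hC : 0 < C) (hpC : ∀ x, ‖p x‖ ≤ C) (hφc : ∀ x, ‖φ x‖ ≤ c * Real.exp (2 * C * |x|)) :
    ∃ N, IsSwapSolution p φ N := by
  set w : ℝ × ℝ → ℝ := fun z => Real.exp (2 * C * (|z.1| + |z.2|)) with hw
  have hwc : Continuous w := by fun_prop
  have hwp : ∀ z, 0 < w z := fun z => Real.exp_pos _
  have hwz : ∀ z, (w z : ℂ) ≠ 0 := fun z => Complex.ofReal_ne_zero.2 (hwp z).ne'
  have hint : ∀ y : BoundedContinuousFunction (ℝ × ℝ) ℂ, Continuous fun z : ℝ × ℝ =>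
      ∫ s in (0 : ℝ)..z.1, p (s + z.2) * (w (z.2, s) * y (z.2, s)) := fun y =>
    continuous_primitive_fst (g := fun z => p (z.1 + z.2) * (w (z.2, z.1) * y (z.2, z.1)))
      (by fun_prop)
  have hbound : ∀ (y : BoundedContinuousFunction (ℝ × ℝ) ℂ) (z : ℝ × ℝ),
      ‖(∫ s in (0 : ℝ)..z.1, p (s + z.2) * (w (z.2, s) * y (z.2, s))) / w z‖ ≤ 1 / 2 * ‖y‖ := by
    rintro y ⟨u, v⟩
    rw [norm_div, Complex.norm_real, Real.norm_of_nonneg (hwp _).le, div_le_iff₀ (hwp _)]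
    refine (norm_integral_le_exp (M := C * ‖y‖ * Real.exp (2 * C * |v|)) (l := 2 * C) (by positivity)
      (by positivity) u ?_).trans (le_of_eq ?_)
    · intro s _
      rw [norm_mul, norm_mul, Complex.norm_real, Real.norm_of_nonneg (hwp _).le]
      calc _ ≤ C * (w (v, s) * ‖y‖) := mul_le_mul (hpC _)
            (mul_le_mul_of_nonneg_left (y.norm_coe_le_norm _) (hwp _).le)
            (mul_nonneg (hwp _).le (norm_nonneg _)) hC.le
        _ = _ := by simp only [hw, mul_add, Real.exp_add]; ring
    · simp only [hw, mul_add, Real.exp_add]; field_simp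
  have hφb : ∀ z : ℝ × ℝ, ‖φ z.2 / w z‖ ≤ c := by
    rintro ⟨u, v⟩
    rw [norm_div, Complex.norm_real, Real.norm_of_nonneg (hwp _).le, div_le_iff₀ (hwp _)]
    have hc0 : 0 ≤ c := by simpa using (norm_nonneg _).trans (hφc 0)
    refine (hφc v).trans (mul_le_mul_of_nonneg_left (Real.exp_le_exp.2 ?_) hc0)
    exact mul_le_mul_of_nonneg_left (by simp) (by positivity)
  have hex : ∀ y : BoundedContinuousFunction (ℝ × ℝ) ℂ,
      ∃ y' : BoundedContinuousFunction (ℝ × ℝ) ℂ, ∀ z, y' z = φ z.2 / w z +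
        (∫ s in (0 : ℝ)..z.1, p (s + z.2) * (w (z.2, s) * y (z.2, s))) / w z := fun y =>
    ⟨BoundedContinuousFunction.ofNormedAddCommGroup _
      (((hφ.comp continuous_snd).div (by fun_prop) hwz).add ((hint y).div (by fun_prop) hwz))
      (c + 1 / 2 * ‖y‖) (fun z => (norm_add_le _ _).trans (add_le_add (hφb z) (hbound y z))), fun _ => rfl⟩
  clear_value w
  choose Φ hΦe using hex
  obtain ⟨K, hK⟩ : ∃ K : NNReal, (K : ℝ) = 1 / 2 := ⟨1 / 2, by simp⟩
  have hΦ : ContractingWith K Φ := by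
    refine ⟨by rw [← NNReal.coe_lt_coe, hK]; norm_num, LipschitzWith.of_dist_le_mul fun y y' => ?_⟩
    rw [BoundedContinuousFunction.dist_le (by positivity)]
    intro z
    have hi : ∀ y : BoundedContinuousFunction (ℝ × ℝ) ℂ, IntervalIntegrable
        (fun s => p (s + z.2) * (w (z.2, s) * y (z.2, s))) volume 0 z.1 := fun y =>
      (by fun_prop : Continuous fun s =>
        p (s + z.2) * (w (z.2, s) * y (z.2, s))).intervalIntegrable _ _
    have := hbound (y - y') z
    have e : (fun s => p (s + z.2) * (w (z.2, s) * (y - y') (z.2, s))) = fun s =>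
        p (s + z.2) * (w (z.2, s) * y (z.2, s)) - p (s + z.2) * (w (z.2, s) * y' (z.2, s)) := by
      funext s
      simp only [BoundedContinuousFunction.coe_sub, Pi.sub_apply]
      ring
    rw [e, intervalIntegral.integral_sub (hi y) (hi y')] at this
    rw [dist_eq_norm, dist_eq_norm, hΦe, hΦe, add_sub_add_left_eq_sub, ← sub_div, hK]
    exact this
  obtain ⟨y, hy⟩ : ∃ y, Φ y = y := ⟨_, hΦ.fixedPoint_isFixedPt⟩
  refine ⟨fun z => w z * y z, by fun_prop, fun u v => ?_⟩
  have := hΦe y (u, v)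
  rw [hy] at this
  rw [this, ← add_div, mul_div_cancel₀ _ (hwz _)]

variable {p φ : ℝ → ℂ} {N N' : ℝ × ℝ → ℂ}

theorem IsSwapSolution.unique {C : ℝ} (hp : Continuous p) (hC : 0 < C) (hpC : ∀ x, ‖p x‖ ≤ C)
    (h : IsSwapSolution p φ N) (h' : IsSwapSolution p φ N') : N = N' := by
  have hN := h.cont
  have hN' := h'.cont
  have key : ∀ u v, N (u, v) - N' (u, v) =
      ∫ s in (0 : ℝ)..u, p (s + v) * (N (v, s) - N' (v, s)) := by
    intro u v
    rw [h.eq, h'.eq, add_sub_add_left_eq_sub, ← intervalIntegral.integral_sub]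
    · simp only [mul_sub]
    · exact (by fun_prop : Continuous fun s => p (s + v) * N (v, s)).intervalIntegrable _ _
    · exact (by fun_prop : Continuous fun s => p (s + v) * N' (v, s)).intervalIntegrable _ _
  funext ⟨u, v⟩
  -- The difference and its swap form a coupled Volterra pair; the square is chosen to pass through
  -- the given point.
  refine sub_eq_zero.1 (eq_zero_of_volterra_pair (ρ := |u| + |v|) (by positivity) hC
    (α := fun z => N z - N' z) (β := fun z => N z.swap - N' z.swap)
    (A := fun z => p (z.1 + z.2)) (B := fun z => p (z.1 + z.2))
    (by fun_prop) (by unfold Prod.swap; fun_prop) (fun _ _ => hpC _) (fun _ _ => hpC _)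
    (fun u v _ => key u v) (fun u v _ => ?_) (u, v) (le_refl (|u| + |v|))).1
  simpa only [Prod.swap, add_comm] using key v u

/-- The integrand contains N(v, s), so differentiating in v falls on the first variable of N, where
the equation already supplies the derivative p(v + s) N(s, v). Regularity in v therefore comes for
free. -/
theorem IsSwapSolution.hasPartials {p' φ' : ℝ → ℂ} (hp : ∀ x, HasDerivAt p (p' x) x)
    (hp' : Continuous p') (hφ : ∀ x, HasDerivAt φ (φ' x) x) (hφ' : Continuous φ')
    (h : IsSwapSolution p φ N) :
    HasPartials N (fun z => p (z.1 + z.2) * N (z.2, z.1))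
      (fun z => φ' z.2 + ∫ s in (0 : ℝ)..z.1,
        (p' (s + z.2) * N (z.2, s) + p (s + z.2) ^ 2 * N (s, z.2))) := by
  have hN := h.cont
  have hpc : Continuous p := continuous_iff_continuousAt.2 fun x => (hp x).continuousAt
  have hd : ∀ u v, HasDerivAt (fun s => N (s, v)) (p (u + v) * N (v, u)) u := by
    intro u v
    simp only [h.eq _ v]
    have hc : Continuous fun s => p (s + v) * N (v, s) := by fun_prop
    exact (intervalIntegral.integral_hasDerivAt_right (hc.intervalIntegrable _ _)
      (hc.stronglyMeasurableAtFilter _ _) hc.continuousAt).const_add _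
  have h1 := hasPartials_primitive (g := fun z => p (z.1 + z.2) * N (z.2, z.1))
    (g' := fun z => p' (z.1 + z.2) * N (z.2, z.1) + p (z.1 + z.2) ^ 2 * N (z.1, z.2))
    (by fun_prop) (by fun_prop) (fun s v => by
      have := ((hp (s + v)).comp_const_add s v).mul (hd v s)
      convert! this using 1
      rw [add_comm v s]; ring)
  exact ⟨hN, h1.cont₁, (hφ'.comp continuous_snd).add h1.cont₂, hd, fun u v => by
    have e' : (fun s => N (u, s)) = fun s => φ s + ∫ r in (0 : ℝ)..u, p (r + s) * N (s, r) :=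
      funext fun s => h.eq u s
    rw [e']
    exact (hφ v).add (h1.deriv₂ u v)⟩

end

/-! ### The kernel built from the swap solutions, and the unit wave. -/

section

/-- `p` is bounded by `C > 0` and has the continuous derivative `p'`. -/
structure IsBoundedC1 (p p' : ℝ → ℂ) (C : ℝ) : Prop where
  hasDerivAt : ∀ x, HasDerivAt p (p' x) x
  cont' : Continuous p'
  pos : 0 < C
  bound : ∀ x, ‖p x‖ ≤ C

variable {p p' φ φ' : ℝ → ℂ} {C : ℝ}

theorem IsBoundedC1.cont (h : IsBoundedC1 p p' C) : Continuous p :=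
  continuous_iff_continuousAt.2 fun x => (h.hasDerivAt x).continuousAt

theorem IsBoundedC1.neg (h : IsBoundedC1 p p' C) :
    IsBoundedC1 (fun x => -p x) (fun x => -p' x) C :=
  ⟨fun x => (h.hasDerivAt x).neg, h.cont'.neg, h.pos, fun x => by simpa using h.bound x⟩

theorem IsBoundedC1.exists_half (h : IsBoundedC1 p p' C) :
    ∃ N, IsSwapSolution p (fun x => p x / 2) N := by
  have hc := h.cont
  refine exists_isSwapSolution (c := C) h.cont (by fun_prop) h.pos h.bound fun x => ?_
  have h1 : 1 ≤ Real.exp (2 * C * |x|) :=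
    Real.one_le_exp (mul_nonneg (by linarith [h.pos]) (abs_nonneg x))
  have h2 := h.bound x
  have h3 := norm_nonneg (p x)
  rw [norm_div, RCLike.norm_ofNat]
  nlinarith [h.pos]

theorem hasDerivAt_exp_neg_integral (hp : Continuous p) (x : ℝ) :
    HasDerivAt (fun x => Complex.exp (-∫ s in (0 : ℝ)..x, p s))
      (-p x * Complex.exp (-∫ s in (0 : ℝ)..x, p s)) x := by
  have := (intervalIntegral.integral_hasDerivAt_right (hp.intervalIntegrable 0 x)
    (hp.stronglyMeasurableAtFilter _ _) hp.continuousAt).neg.cexp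
  convert! this using 1
  simp only [Pi.neg_apply]
  ring

/-- Only |exp(-∫ p)| ≤ exp(C|x|) is known for this datum, which is still dominated by the weight. -/
theorem IsBoundedC1.exists_exp (h : IsBoundedC1 p p' C) :
    ∃ N, IsSwapSolution p (fun x => Complex.exp (-∫ s in (0 : ℝ)..x, p s)) N := by
  refine exists_isSwapSolution (c := 1) h.cont
    (continuous_iff_continuousAt.2 fun x => (hasDerivAt_exp_neg_integral h.cont x).continuousAt)
    h.pos h.bound fun x => ?_
  rw [Complex.norm_exp, one_mul, Real.exp_le_exp]
  have h1 := intervalIntegral.norm_integral_le_of_norm_le_const (a := 0) (b := x)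
    (fun s _ => h.bound s)
  have h2 := Complex.re_le_norm (-∫ s in (0 : ℝ)..x, p s)
  rw [norm_neg] at h2
  rw [sub_zero] at h1
  nlinarith [h.pos, abs_nonneg x]

/-- `N` and its derivatives: `N₂ = ∂N/∂v`, and the mixed derivative. -/
theorem IsSwapSolution.exists_partials {N : ℝ × ℝ → ℂ} (hp : IsBoundedC1 p p' C)
    (hφ : ∀ x, HasDerivAt φ (φ' x) x) (hφ' : Continuous φ') (h : IsSwapSolution p φ N) :
    ∃ N₂, HasPartials N (fun z => p (z.1 + z.2) * N (z.2, z.1)) N₂ ∧ (∀ v, N₂ (0, v) = φ' v) ∧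
      ∀ u v, HasDerivAt (fun s => N₂ (s, v))
        (p' (u + v) * N (v, u) + p (u + v) ^ 2 * N (u, v)) u := by
  have hN := h.cont
  have hpc := hp.cont
  have hp'c := hp.cont'
  refine ⟨_, h.hasPartials hp.hasDerivAt hp.cont' hφ hφ', by simp, fun u v => ?_⟩
  have hc : Continuous fun s => p' (s + v) * N (v, s) + p (s + v) ^ 2 * N (s, v) := by fun_prop
  exact (intervalIntegral.integral_hasDerivAt_right (hc.intervalIntegrable 0 u)
    (hc.stronglyMeasurableAtFilter _ _) hc.continuousAt).const_add (φ' v)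

/-- `g` has continuous partial derivatives and `∂²g/∂u∂v = q(u + v) g`. -/
structure IsWave (q : ℝ → ℂ) (g g₁ g₂ : ℝ × ℝ → ℂ) : Prop extends HasPartials g g₁ g₂ where
  mixed : ∀ u v, HasDerivAt (fun s => g₂ (s, v)) (q (u + v) * g (u, v)) u

theorem hasDerivAt_swap {N N₁ N₂ : ℝ × ℝ → ℂ} (hp : IsBoundedC1 p p' C)
    (hN : HasPartials N N₁ N₂) (u v : ℝ) :
    HasDerivAt (fun s => p (v + s) * N (s, v))
      (p' (u + v) * N (u, v) + p (u + v) * N₁ (u, v)) u := by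
  have := ((hp.hasDerivAt (v + u)).comp_const_add v u).mul (hN.deriv₁ u v)
  rwa [add_comm v u] at this

variable {Sp Sm N : ℝ × ℝ → ℂ}

/-- The kernel assembled from the solutions `Sp`, `Sm` of the swap equations for `p` and `-p`. -/
noncomputable def dressKernel (Sp Sm : ℝ × ℝ → ℂ) (z : ℝ × ℝ) : ℂ :=
  1 / 2 * (Sp z + Sm z + (Sp z.swap - Sm z.swap))

/-- Differentiating the swap equation gives ∂_u∂_v Sp = p' Sp∘swap + p² Sp, and likewise for Sm with
p' replaced by -p'. In the combination defining the kernel, the p' and p² terms each reassemble to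
the kernel itself. -/
theorem dressKernel_isWave (hp : IsBoundedC1 p p' C) (hSp : IsSwapSolution p (fun x => p x / 2) Sp)
    (hSm : IsSwapSolution (fun x => -p x) (fun x => -p x / 2) Sm) :
    ∃ Sp₂ Sm₂, IsWave (fun x => p' x + p x ^ 2) (dressKernel Sp Sm)
      (fun z => 1 / 2 * (p (z.1 + z.2) * Sp z.swap + -p (z.1 + z.2) * Sm z.swap +
        (Sp₂ z.swap - Sm₂ z.swap)))
      (fun z => 1 / 2 * (Sp₂ z + Sm₂ z +
        (p (z.2 + z.1) * Sp z - -p (z.2 + z.1) * Sm z))) ∧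
      HasPartials Sp (fun z => p (z.1 + z.2) * Sp z.swap) Sp₂ ∧
      HasPartials Sm (fun z => -p (z.1 + z.2) * Sm z.swap) Sm₂ := by
  obtain ⟨Sp₂, hSp1, -, hSp2⟩ := hSp.exists_partials hp (fun x => (hp.hasDerivAt x).div_const 2)
    (hp.cont'.div_const 2)
  obtain ⟨Sm₂, hSm1, -, hSm2⟩ := hSm.exists_partials hp.neg
    (fun x => (hp.hasDerivAt x).neg.div_const 2) (hp.cont'.neg.div_const 2)
  refine ⟨Sp₂, Sm₂, ⟨((hSp1.add hSm1).add (hSp1.swap.sub hSm1.swap)).const_mul (1 / 2),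
    fun u v => ?_⟩, hSp1, hSm1⟩
  have := (((hSp2 u v).add (hSm2 u v)).add
    ((hasDerivAt_swap hp hSp1 u v).sub (hasDerivAt_swap hp.neg hSm1 u v))).const_mul (1 / 2)
  convert! this using 1
  simp only [dressKernel, Prod.swap]
  ring

theorem dressKernel_left (hp : Continuous p) (hSp : IsSwapSolution p (fun x => p x / 2) Sp)
    (hSm : IsSwapSolution (fun x => -p x) (fun x => -p x / 2) Sm) (u : ℝ) :
    dressKernel Sp Sm (u, 0) = 1 / 2 * (p u + ∫ s in (0 : ℝ)..u, p s ^ 2) := by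
  have hSpc := hSp.cont
  have hSmc := hSm.cont
  have h0 : ∀ s, Sp (0, s) - Sm (0, s) = p s := fun s => by
    rw [hSp.eq, hSm.eq]; simp; ring
  have h1 : Sp (u, 0) + Sm (u, 0) = ∫ s in (0 : ℝ)..u, p s ^ 2 := by
    rw [hSp.eq, hSm.eq, add_add_add_comm, ← intervalIntegral.integral_add
      ((by fun_prop : Continuous fun s => p (s + 0) * Sp (0, s)).intervalIntegrable _ _)
      ((by fun_prop : Continuous fun s => -p (s + 0) * Sm (0, s)).intervalIntegrable _ _)]
    rw [show p 0 / 2 + -p 0 / 2 = 0 by ring, zero_add]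
    refine intervalIntegral.integral_congr fun s _ => ?_
    simp only [add_zero]
    rw [sq]
    -- One factor of p² is traded for Sp(0, s) - Sm(0, s).
    nth_rw 4 [← h0 s]
    ring
  rw [dressKernel, h1, Prod.swap, h0]
  ring

theorem dressKernel_right (hSp : IsSwapSolution p (fun x => p x / 2) Sp)
    (hSm : IsSwapSolution (fun x => -p x) (fun x => -p x / 2) Sm) (v : ℝ) :
    dressKernel Sp Sm (0, v) = p 0 / 2 := by
  have h0 : ∀ s, Sp (0, s) = p s / 2 := fun s => by rw [hSp.eq]; simp
  have h0' : ∀ s, Sm (0, s) = -p s / 2 := fun s => by rw [hSm.eq]; simp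
  rw [dressKernel, Prod.swap, hSp.eq v, hSm.eq v]
  simp only [h0, h0']
  rw [intervalIntegral.integral_congr (g := fun s => p (s + 0) * (p s / 2))
    (f := fun s => -p (s + 0) * (-p s / 2)) (fun s _ => by simp only; ring)]
  ring

/-- Swapping (u, v) is t ↦ -t, so this computes the integrand K(x, s) - K(x, -s) in the definition
of the kernel. -/
theorem dressKernel_sub_swap (z : ℝ × ℝ) :
    dressKernel Sp Sm z - dressKernel Sp Sm z.swap = Sm z - Sm z.swap := by
  simp only [dressKernel, Prod.swap_swap]
  ring

theorem integral_mul_exp_neg_integral (hp : Continuous p) (v : ℝ) :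
    ∫ s in (0 : ℝ)..v, p s * Complex.exp (-∫ r in (0 : ℝ)..s, p r) =
      1 - Complex.exp (-∫ r in (0 : ℝ)..v, p r) := by
  have hc : Continuous fun x => Complex.exp (-∫ s in (0 : ℝ)..x, p s) :=
    continuous_iff_continuousAt.2 fun x => (hasDerivAt_exp_neg_integral hp x).continuousAt
  have := intervalIntegral.integral_eq_sub_of_hasDerivAt (a := 0) (b := v)
    (fun x _ => (hasDerivAt_exp_neg_integral hp x).neg)
    ((by fun_prop : Continuous fun x => -(-p x *
      Complex.exp (-∫ s in (0 : ℝ)..x, p s))).intervalIntegrable _ _)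
  simp only [neg_mul, neg_neg] at this
  rw [this]
  simp
  ring

/-- The solution of the wave equation equal to one on both characteristics, and its derivative
along `t`. -/
theorem exists_unit_wave (hp : IsBoundedC1 p p' C)
    (hSm : IsSwapSolution (fun x => -p x) (fun x => -p x / 2) Sm) :
    ∃ R R₁ R₂, IsWave (fun x => p' x + p x ^ 2) R R₁ R₂ ∧ (∀ u, R (u, 0) = 1) ∧
      (∀ v, R (0, v) = 1) ∧ (∀ z, R z.swap = R z) ∧
      ∀ z, R₁ z - R₂ z = -2 * (Sm z - Sm z.swap) := by
  obtain ⟨N, hN⟩ := hp.exists_exp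
  have hpc := hp.cont
  set ω : ℝ → ℂ := fun x => Complex.exp (-∫ s in (0 : ℝ)..x, p s) with hω
  have hωd : ∀ x, HasDerivAt ω (-p x * ω x) x := hasDerivAt_exp_neg_integral hpc
  have hωc : Continuous ω := continuous_iff_continuousAt.2 fun x => (hωd x).continuousAt
  have hω0 : ω 0 = 1 := by simp [hω]
  obtain ⟨N₂, h1, h2, h3⟩ := hN.exists_partials hp hωd (by fun_prop)
  have hN0 : ∀ s, N (0, s) = ω s := fun s => by rw [hN.eq]; simp
  have hN1 : ∀ s, N (s, 0) = 2 - ω s := fun s => by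
    rw [hN.eq]
    simp only [hN0, add_zero]
    rw [integral_mul_exp_neg_integral hpc, hω0, hω]
    ring
  -- Calling this function Y, R₁ - R₂ = -(Y - Y∘swap). The initial value is (-pω - p(2 - ω))/2 = -p,
  -- so Y solves the same swap problem as 2 Sm and equals it.
  have hY : IsSwapSolution (fun x => -p x) (fun x => -p x)
      (fun z => 1 / 2 * (N₂ z - p (z.1 + z.2) * N z.swap)) := by
    have hNc := hN.cont
    have hN2c := h1.cont₂
    refine ⟨by unfold Prod.swap; fun_prop, fun u v => ?_⟩
    have hd : ∀ u, HasDerivAt (fun s => 1 / 2 * (N₂ (s, v) - p (s + v) * N (v, s)))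
        (-p (u + v) * (1 / 2 * (N₂ (v, u) - p (v + u) * N (u, v)))) u := by
      intro u
      have := ((h3 u v).sub (((hp.hasDerivAt (u + v)).comp_add_const u v).mul
        (h1.deriv₂ v u))).const_mul (1 / 2)
      convert! this using 1
      rw [add_comm v u]
      ring
    have := intervalIntegral.integral_eq_sub_of_hasDerivAt (a := 0) (b := u) (fun s _ => hd s)
      ((by fun_prop : Continuous fun u =>
        -p (u + v) * (1 / 2 * (N₂ (v, u) - p (v + u) * N (u, v)))).intervalIntegrable _ _)
    simp only [Prod.swap]
    rw [this, h2, hN1]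
    simp only [zero_add]
    ring
  have hY' : IsSwapSolution (fun x => -p x) (fun x => -p x) (fun z => 2 * Sm z) := by
    refine ⟨hSm.cont.const_mul 2, fun u v => ?_⟩
    simp only [mul_left_comm _ (2 : ℂ)]
    rw [intervalIntegral.integral_const_mul]
    conv_lhs => rw [hSm.eq]
    ring
  have hYS := congrFun (hY.unique hp.neg.cont hp.pos hp.neg.bound hY')
  refine ⟨_, _, _, ⟨(h1.add h1.swap).const_mul (1 / 2), fun u v => ?_⟩, fun u => ?_, fun v => ?_,
    fun z => ?_, fun z => ?_⟩
  · have := ((h3 u v).add (hasDerivAt_swap hp h1 u v)).const_mul (1 / 2)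
    convert! this using 1
    simp only [Prod.swap]
    ring
  · simp only [Prod.swap, hN0, hN1]
    ring
  · simp only [Prod.swap, hN0, hN1]
    ring
  · simp only [Prod.swap_swap]
    ring
  · have e1 := hYS z
    have e2 := hYS z.swap
    simp only [Prod.swap] at e1 e2 ⊢
    linear_combination -e1 + e2

end

/-! ### Uniqueness for the Goursat problem and identification of the kernel. -/

section

theorem mem_goursatDomain {a : ℝ} {z : ℝ × ℝ} : z ∈ goursatDomain a ↔ |z.1| + |z.2| ≤ a :=
  Iff.rfl

theorem goursatDomain_subset_closure (a : ℝ) (ha : 0 < a) :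
    goursatDomain a ⊆ closure {z : ℝ × ℝ | |z.1| + |z.2| < a} := by
  intro z hz
  have ht : Filter.Tendsto (fun t : ℝ => t • z) (nhdsWithin 1 (Iio 1)) (nhds z) := by
    have : Continuous fun t : ℝ => t • z := by fun_prop
    simpa using this.continuousWithinAt.tendsto (x := (1 : ℝ)) (s := Iio 1)
  refine mem_closure_of_tendsto ht ?_
  filter_upwards [Ioo_mem_nhdsLT (show (0 : ℝ) < 1 by norm_num)] with t ht
  have hz' : |z.1| + |z.2| ≤ a := hz
  change |(t • z).1| + |(t • z).2| < a
  simp only [Prod.smul_fst, Prod.smul_snd, smul_eq_mul, abs_mul, abs_of_pos ht.1]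
  nlinarith [ht.1, ht.2, abs_nonneg z.1, abs_nonneg z.2]

theorem abs_le_of_mem_uIcc_zero {s u : ℝ} (hs : s ∈ uIcc 0 u) : |s| ≤ |u| := by
  simpa using abs_sub_left_of_mem_uIcc hs

theorem IsGoursatSolution.exists_deriv {a : ℝ} {q : ℝ → ℂ} {H : ℝ × ℝ → ℂ}
    (h : IsGoursatSolution a q H) :
    ContinuousOn (fun z : ℝ × ℝ => deriv (fun r => H (z.1, r)) z.2) {z | |z.1| + |z.2| < a} ∧
    ∀ u v : ℝ, |u| + |v| < a →
      HasDerivAt (fun r => H (u, r)) (deriv (fun r => H (u, r)) v) v := by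
  have hopen : IsOpen {z : ℝ × ℝ | |z.1| + |z.2| < a} := isOpen_lt (by fun_prop) continuous_const
  have hcd : ContDiffOn ℝ 1 H {z | |z.1| + |z.2| < a} := h.contDiffOn.mono fun z hz => mem_goursatDomain.2 (le_of_lt hz)
  have hd : ∀ u v : ℝ, |u| + |v| < a →
      HasDerivAt (fun r => H (u, r)) (fderiv ℝ H (u, v) (0, 1)) v := fun u v huv => by
    have := ((hcd.differentiableOn one_ne_zero).differentiableAt
      (hopen.mem_nhds (show (u, v) ∈ {z : ℝ × ℝ | |z.1| + |z.2| < a} from huv))).hasFDerivAt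
    exact this.comp_hasDerivAt v ((hasDerivAt_const v u).prodMk (hasDerivAt_id v))
  refine ⟨?_, fun u v huv => (hd u v huv).differentiableAt.hasDerivAt⟩
  refine ((hcd.continuousOn_fderiv_of_isOpen hopen le_rfl).clm_apply
    (continuousOn_const (c := ((0 : ℝ), (1 : ℝ))))).congr fun z hz => (hd z.1 z.2 hz).deriv

/-- For the difference W, the pair (∂W/∂v, W) is a Volterra pair with coefficients q and 1. The
mixed equation holds only in the open square, so the argument runs on squares of radius ρ < a and
continuity reaches the boundary. -/
theorem goursat_unique {a : ℝ} (ha : 0 < a) {q : ℝ → ℂ} (hq : ContinuousOn q (Icc (-a) a))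
    {H H' : ℝ × ℝ → ℂ} (h : IsGoursatSolution a q H) (h' : IsGoursatSolution a q H') :
    EqOn H H' (goursatDomain a) := by
  refine EqOn.of_subset_closure (s := {z : ℝ × ℝ | |z.1| + |z.2| < a}) ?_
    h.contDiffOn.continuousOn h'.contDiffOn.continuousOn (fun z hz => mem_goursatDomain.2 (le_of_lt hz))
    (goursatDomain_subset_closure a ha)
  rintro ⟨u, v⟩ (huv : |u| + |v| < a)
  set ρ := |u| + |v| with hρ
  obtain ⟨hc, hd⟩ := h.exists_deriv
  obtain ⟨hc', hd'⟩ := h'.exists_deriv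
  have hsub : goursatDomain ρ ⊆ {z : ℝ × ℝ | |z.1| + |z.2| < a} := fun z hz => lt_of_le_of_lt hz huv
  have hsub' : goursatDomain ρ ⊆ goursatDomain a := fun z hz => mem_goursatDomain.2 (le_of_lt (hsub hz))
  have hmap : MapsTo (fun z : ℝ × ℝ => z.1 + z.2) (goursatDomain ρ) (Icc (-a) a) := fun z hz =>
    abs_le.1 ((abs_add_le _ _).trans (hsub hz).le)
  obtain ⟨M, hM⟩ := isCompact_Icc.exists_bound_of_continuousOn hq
  have hW : ContinuousOn (fun z => H z - H' z) (goursatDomain ρ) :=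
    (h.contDiffOn.continuousOn.sub h'.contDiffOn.continuousOn).mono hsub'
  have hα : ContinuousOn (fun z : ℝ × ℝ => deriv (fun r => H (z.1, r)) z.2 -
    deriv (fun r => H' (z.1, r)) z.2) (goursatDomain ρ) := (hc.sub hc').mono hsub
  have hqW : ContinuousOn (fun z : ℝ × ℝ => q (z.1 + z.2) * (H z - H' z)) (goursatDomain ρ) :=
    (hq.comp (by fun_prop) hmap).mul hW
  have hα0 : ∀ r : ℝ, |r| < a → deriv (fun r => H (0, r)) r - deriv (fun r => H' (0, r)) r = 0 := by
    intro r hr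
    rw [sub_eq_zero]
    refine Filter.EventuallyEq.deriv_eq ?_
    filter_upwards [(isOpen_lt continuous_abs continuous_const).mem_nhds hr] with y hy
    rw [h.right y (abs_le.1 (le_of_lt hy)), h'.right y (abs_le.1 (le_of_lt hy))]
  have hrow : ∀ {x y s : ℝ}, (x, y) ∈ goursatDomain ρ → s ∈ uIcc 0 x →
      (s, y) ∈ goursatDomain ρ := fun hxy hs =>
    (add_le_add_left (abs_le_of_mem_uIcc_zero hs) _).trans hxy
  have hcol : ∀ {x y s : ℝ}, (x, y) ∈ goursatDomain ρ → s ∈ uIcc 0 y →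
      (x, s) ∈ goursatDomain ρ := fun hxy hs =>
    (add_le_add_right (abs_le_of_mem_uIcc_zero hs) _).trans hxy
  refine sub_eq_zero.1 (eq_zero_of_volterra_pair (ρ := ρ) (C := max M 1) (by positivity)
    (by positivity) (A := fun z => q (z.1 + z.2)) (B := fun _ => 1) hα hW
    (fun z hz => (hM _ (hmap hz)).trans (le_max_left _ _)) (fun z _ => by simp) ?_ ?_
    (u, v) (le_refl ρ)).2
  · intro x y hxy
    rw [intervalIntegral.integral_eq_sub_of_hasDerivAt
      (f := fun s => deriv (fun r => H (s, r)) y - deriv (fun r => H' (s, r)) y) (fun s hs => ?_)]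
    · have := hα0 y (by simpa using show _ < a from hsub (hrow hxy left_mem_uIcc))
      rw [this, sub_zero]
    · exact (hqW.comp (by fun_prop : ContinuousOn (fun s : ℝ => (s, y)) _)
        fun s hs => hrow hxy hs).intervalIntegrable
    · rw [mul_sub]
      exact (h.mixed_deriv s y (hsub (hrow hxy hs))).sub (h'.mixed_deriv s y (hsub (hrow hxy hs)))
  · intro x y hxy
    simp only [one_mul]
    rw [intervalIntegral.integral_eq_sub_of_hasDerivAt
      (f := fun s => H (x, s) - H' (x, s)) (fun s hs => ?_)]
    · have hx : x ∈ Icc (-a) a := abs_le.1 (by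
        simpa using mem_goursatDomain.1 (hsub' (hcol hxy left_mem_uIcc)))
      rw [h.left x hx, h'.left x hx, sub_self, sub_zero]
    · exact (hα.comp (by fun_prop : ContinuousOn (fun s : ℝ => (x, s)) _)
        fun s hs => hcol hxy hs).intervalIntegrable
    · exact (hd x s (hsub (hcol hxy hs))).sub (hd' x s (hsub (hcol hxy hs)))

theorem IsWave.sub_const_mul {q : ℝ → ℂ} {g g₁ g₂ k k₁ k₂ : ℝ × ℝ → ℂ} (h : IsWave q g g₁ g₂)
    (h' : IsWave q k k₁ k₂) (c : ℂ) :
    IsWave q (fun z => g z - c * k z) (fun z => g₁ z - c * k₁ z) (fun z => g₂ z - c * k₂ z) :=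
  ⟨h.toHasPartials.sub (h'.toHasPartials.const_mul c), fun u v => by
    have := (h.mixed u v).sub ((h'.mixed u v).const_mul c)
    convert! this using 1
    ring⟩

theorem IsWave.isGoursatSolution {a : ℝ} {q q₀ : ℝ → ℂ} {H H₁ H₂ : ℝ × ℝ → ℂ}
    (h : IsWave q₀ H H₁ H₂) (hq : EqOn q q₀ (Icc (-a) a))
    (hl : ∀ u ∈ Icc (-a) a, H (u, 0) = (1 / 2 : ℂ) * ∫ s in (0 : ℝ)..u, q s)
    (hr : ∀ v ∈ Icc (-a) a, H (0, v) = 0) : IsGoursatSolution a q H where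
  contDiffOn := h.contDiff.contDiffOn
  mixed_deriv u v huv := by
    rw [hq (abs_le.1 ((abs_add_le u v).trans huv.le))]
    simpa only [(h.deriv₂ _ _).deriv] using h.mixed u v
  left := hl
  right := hr

variable {a : ℝ} {p p' q : ℝ → ℂ} {C : ℝ} {Sp Sm : ℝ × ℝ → ℂ}

theorem goursatSolution_spec (ha : 0 < a) (hp : IsBoundedC1 p p' C)
    (hSp : IsSwapSolution p (fun x => p x / 2) Sp)
    (hSm : IsSwapSolution (fun x => -p x) (fun x => -p x / 2) Sm)
    (hq : EqOn q (fun x => p' x + p x ^ 2) (Icc (-a) a)) :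
    IsGoursatSolution a q (goursatSolution a q) ∧
      ∀ x ∈ Icc (-a) a, ∀ t ∈ Icc (-a) a,
        kernelH a q (p 0) x t = dressKernel Sp Sm ((x + t) / 2, (x - t) / 2) := by
  have hpc := hp.cont
  have hp'c := hp.cont'
  obtain ⟨Sp₂, Sm₂, hA, -, -⟩ := dressKernel_isWave hp hSp hSm
  obtain ⟨R, R₁, R₂, hR, hR1, hR2, hRsym, hRt⟩ := exists_unit_wave hp hSm
  have hint : ∀ u ∈ Icc (-a) a, ∫ s in (0 : ℝ)..u, q s = p u - p 0 + ∫ s in (0 : ℝ)..u, p s ^ 2 := by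
    intro u hu
    rw [intervalIntegral.integral_congr (g := fun x => p' x + p x ^ 2), intervalIntegral.integral_add
      (hp'c.intervalIntegrable _ _)
      ((by fun_prop : Continuous fun s => p s ^ 2).intervalIntegrable _ _),
      intervalIntegral.integral_eq_sub_of_hasDerivAt (fun x _ => hp.hasDerivAt x)
        (hp'c.intervalIntegrable _ _)]
    intro s hs
    exact hq (abs_le.1 ((abs_le_of_mem_uIcc_zero hs).trans (abs_le.2 hu)))
  -- The subtraction corrects both sides: it cancels p(0)/2 on u = 0, and on v = 0 it supplies the
  -- -p(0)/2 in (1/2)∫_0^u (p' + p²).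
  have hH : IsGoursatSolution a q (fun z => dressKernel Sp Sm z - p 0 / 2 * R z) := by
    refine (hA.sub_const_mul hR _).isGoursatSolution hq (fun u hu => ?_) (fun v hv => ?_)
    · rw [hint u hu, dressKernel_left hpc hSp hSm, hR1]
      ring
    · rw [dressKernel_right hSp hSm, hR2]
      ring
  have hG : IsGoursatSolution a q (goursatSolution a q) := Classical.epsilon_spec ⟨_, hH⟩
  have hqc : ContinuousOn q (Icc (-a) a) :=
    (by fun_prop : Continuous fun x => p' x + p x ^ 2).continuousOn.congr hq
  have heq := goursat_unique ha hqc hG hH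
  refine ⟨hG, fun x hx t ht => ?_⟩
  have hk : ∀ s ∈ Icc (-a) a, kernel a q x s =
      dressKernel Sp Sm ((x + s) / 2, (x - s) / 2) - p 0 / 2 * R ((x + s) / 2, (x - s) / 2) := by
    intro s hs
    refine heq (x := ((x + s) / 2, (x - s) / 2)) ?_
    have h1 := abs_le.2 hx
    have h2 := abs_le.2 hs
    change |(x + s) / 2| + |(x - s) / 2| ≤ a
    rcases abs_cases ((x + s) / 2) with h3 | h3 <;> rcases abs_cases ((x - s) / 2) with h4 | h4 <;>
      linarith [hx.1, hx.2, hs.1, hs.2]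
  have hId : ∫ s in t..x, (kernel a q x s - kernel a q x (-s)) =
      R ((x + t) / 2, (x - t) / 2) - 1 := by
    -- Along t the derivative of -R is -(R₁ - R₂)/2, the antisymmetric part of Sm; since R is even
    -- in t, this is also K(x, s) - K(x, -s).
    have hd : ∀ s, HasDerivAt (fun s => -R ((x + s) / 2, (x - s) / 2))
        (Sm ((x + s) / 2, (x - s) / 2) - Sm ((x - s) / 2, (x + s) / 2)) s := by
      intro s
      have := (hR.comp_curve (((hasDerivAt_id s).const_add x).div_const 2)
        (((hasDerivAt_id s).const_sub x).div_const 2)).neg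
      convert! this using 1
      have := hRt ((x + s) / 2, (x - s) / 2)
      simp only [id, Prod.swap] at this ⊢
      push_cast
      linear_combination (1 / 2 : ℂ) * this
    have hSmc := hSm.cont
    rw [intervalIntegral.integral_congr (g := fun s =>
      Sm ((x + s) / 2, (x - s) / 2) - Sm ((x - s) / 2, (x + s) / 2)),
      intervalIntegral.integral_eq_sub_of_hasDerivAt (fun s _ => hd s)
        ((by fun_prop : Continuous fun s =>
          Sm ((x + s) / 2, (x - s) / 2) - Sm ((x - s) / 2, (x + s) / 2)).intervalIntegrable _ _)]
    · rw [show (x + x) / 2 = x by ring, sub_self, zero_div, hR1]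
      ring
    · intro s hs
      have hs' : s ∈ Icc (-a) a := uIcc_subset_Icc ht hx hs
      have hs'' : -s ∈ Icc (-a) a := ⟨by linarith [hs'.2], by linarith [hs'.1]⟩
      have h1 := dressKernel_sub_swap (Sp := Sp) (Sm := Sm) ((x + s) / 2, (x - s) / 2)
      have h2 := hRsym ((x + s) / 2, (x - s) / 2)
      simp only [Prod.swap] at h1 h2
      simp only [hk s hs', hk (-s) hs'', sub_neg_eq_add, ← sub_eq_add_neg]
      linear_combination h1 + p 0 / 2 * h2
  rw [kernelH, hId, hk t ht]
  ring

end

/-! ### Volterra operators: the intertwining relation and invertibility. -/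

section

/-- The Volterra operator `u ↦ u + ∫_{-x}^x A((x + t)/2, (x - t)/2) u(t) dt`. -/
noncomputable def volterra (A : ℝ × ℝ → ℂ) (u : ℝ → ℂ) (x : ℝ) : ℂ :=
  u x + ∫ t in (-x)..x, A ((x + t) / 2, (x - t) / 2) * u t

theorem volterra_congr {a : ℝ} {A : ℝ × ℝ → ℂ} {u v : ℝ → ℂ} (h : EqOn u v (Icc (-a) a)) {x : ℝ}
    (hx : x ∈ Icc (-a) a) : volterra A u x = volterra A v x := by
  rw [volterra, volterra, h hx]
  congr 1
  refine intervalIntegral.integral_congr fun t ht => ?_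
  simp only [h (uIcc_subset_Icc ⟨by linarith [hx.2], by linarith [hx.1]⟩ hx ht)]

variable {a : ℝ} {p p' : ℝ → ℂ} {C : ℝ} {Sp Sm : ℝ × ℝ → ℂ}

/-- This is (∂ - p) T_A = T_B ∂: the Leibniz rule on the left, integration by parts on the right,
and A_x + B_t = pA for the remaining integrals. Exchanging `Sp` and `Sm` exchanges A and B and turns
p into -p, so the companion relation is the same lemma. -/
theorem hasDerivAt_volterra (hp : IsBoundedC1 p p' C)
    (hSp : IsSwapSolution p (fun x => p x / 2) Sp)
    (hSm : IsSwapSolution (fun x => -p x) (fun x => -p x / 2) Sm) {u u' : ℝ → ℂ}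
    (hu : ∀ x, HasDerivAt u (u' x) x) (hu' : Continuous u') (x : ℝ) :
    HasDerivAt (volterra (dressKernel Sp Sm) u)
      (p x * volterra (dressKernel Sp Sm) u x + volterra (dressKernel Sm Sp) u' x) x := by
  have huc : Continuous u := continuous_iff_continuousAt.2 fun x => (hu x).continuousAt
  obtain ⟨Sp₂, Sm₂, ⟨hA, -⟩, hSp1, hSm1⟩ := dressKernel_isWave hp hSp hSm
  have hB : HasPartials (dressKernel Sm Sp) _ _ :=
    ((hSm1.add hSp1).add (hSm1.swap.sub hSp1.swap)).const_mul (1 / 2)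
  set A := dressKernel Sp Sm with hAdef
  set B := dressKernel Sm Sp with hBdef
  have hSp' : IsSwapSolution (fun x => - -p x) (fun x => - -p x / 2) Sp := by
    simpa only [neg_neg] using hSp
  -- These two relations, on t = x and t = -x, match the boundary terms.
  have hA0 : ∀ u, A (u, 0) = p u + B (u, 0) := fun u => by
    rw [hAdef, hBdef, dressKernel_left hp.cont hSp hSm, dressKernel_left hp.neg.cont hSm hSp']
    simp only [neg_sq]
    ring
  have hA1 : ∀ v, A (0, v) = -B (0, v) := fun v => by
    rw [hAdef, hBdef, dressKernel_right hSp hSm, dressKernel_right hSm hSp']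
    ring
  generalize hA₁ : (fun z : ℝ × ℝ => 1 / 2 * (p (z.1 + z.2) * Sp z.swap + -p (z.1 + z.2) * Sm z.swap +
        (Sp₂ z.swap - Sm₂ z.swap))) = A₁ at hA
  generalize hA₂ : (fun z : ℝ × ℝ => 1 / 2 * (Sp₂ z + Sm₂ z +
        (p (z.2 + z.1) * Sp z - -p (z.2 + z.1) * Sm z))) = A₂ at hA
  obtain ⟨B₁, hB₁⟩ : ∃ k : ℝ × ℝ → ℂ, k = fun z : ℝ × ℝ => 1 / 2 * (-p (z.1 + z.2) * Sm z.swap +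
    p (z.1 + z.2) * Sp z.swap + (Sm₂ z.swap - Sp₂ z.swap)) := ⟨_, rfl⟩
  obtain ⟨B₂, hB₂⟩ : ∃ k : ℝ × ℝ → ℂ, k = fun z : ℝ × ℝ => 1 / 2 * (Sm₂ z + Sp₂ z +
    (-p (z.2 + z.1) * Sm z - p (z.2 + z.1) * Sp z)) := ⟨_, rfl⟩
  replace hB : HasPartials B B₁ B₂ := by rw [hB₁, hB₂]; exact hB
  -- Twice A_x + B_t = pA, as ∂_x = (∂_u + ∂_v)/2 and ∂_t = (∂_u - ∂_v)/2.
  have hAB : ∀ z, A₁ z + A₂ z + B₁ z - B₂ z = 2 * (p (z.1 + z.2) * A z) := by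
    intro z
    rw [← hA₁, ← hA₂, hB₁, hB₂, hAdef]
    simp only [dressKernel, add_comm z.2 z.1]
    ring
  have hAc := hA.cont
  have hBc := hB.cont
  have hA1c := hA.cont₁
  have hA2c := hA.cont₂
  have hB1c := hB.cont₁
  have hB2c := hB.cont₂
  have hd := (hu x).add (hasDerivAt_integral_symmetric
    (g := fun z => A ((z.2 + z.1) / 2, (z.2 - z.1) / 2) * u z.1)
    (g' := fun z => 1 / 2 * (A₁ ((z.2 + z.1) / 2, (z.2 - z.1) / 2) +
      A₂ ((z.2 + z.1) / 2, (z.2 - z.1) / 2)) * u z.1)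
    (by fun_prop) (by fun_prop) (fun t y => by
      have := (hA.comp_curve (((hasDerivAt_id y).add_const t).div_const 2)
        (((hasDerivAt_id y).sub_const t).div_const 2)).mul_const (u t)
      convert! this using 1
      simp only [id]
      push_cast
      ring) x)
  have hBt : ∀ t, HasDerivAt (fun t => B ((x + t) / 2, (x - t) / 2))
      (1 / 2 * (B₁ ((x + t) / 2, (x - t) / 2) - B₂ ((x + t) / 2, (x - t) / 2))) t := fun t => by
    have := hB.comp_curve (((hasDerivAt_id t).const_add x).div_const 2)
        (((hasDerivAt_id t).const_sub x).div_const 2)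
    convert! this using 1
    simp only [id]
    push_cast
    ring
  have hparts := intervalIntegral.integral_mul_deriv_eq_deriv_mul (a := -x) (b := x)
    (fun t _ => hBt t) (fun t _ => hu t)
    ((by fun_prop : Continuous fun t => (1 / 2 * (B₁ ((x + t) / 2, (x - t) / 2) -
      B₂ ((x + t) / 2, (x - t) / 2)))).intervalIntegrable _ _) (hu'.intervalIntegrable _ _)
  have hI : ∫ t in (-x)..x, 1 / 2 * (A₁ ((x + t) / 2, (x - t) / 2) +
      A₂ ((x + t) / 2, (x - t) / 2)) * u t =
      p x * (∫ t in (-x)..x, A ((x + t) / 2, (x - t) / 2) * u t) -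
      ∫ t in (-x)..x, 1 / 2 * (B₁ ((x + t) / 2, (x - t) / 2) -
        B₂ ((x + t) / 2, (x - t) / 2)) * u t := by
    rw [← intervalIntegral.integral_const_mul, ← intervalIntegral.integral_sub
      ((by fun_prop : Continuous fun t =>
        p x * (A ((x + t) / 2, (x - t) / 2) * u t)).intervalIntegrable _ _)
      ((by fun_prop : Continuous fun t => 1 / 2 * (B₁ ((x + t) / 2, (x - t) / 2) -
        B₂ ((x + t) / 2, (x - t) / 2)) * u t).intervalIntegrable _ _)]
    refine intervalIntegral.integral_congr fun t _ => ?_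
    have := hAB ((x + t) / 2, (x - t) / 2)
    rw [show (x + t) / 2 + (x - t) / 2 = x by ring] at this
    linear_combination (1 / 2 * u t) * this
  convert! hd using 1
  rw [volterra, volterra, hparts]
  simp only [hI]
  simp only [sub_self, zero_div, add_self_div_two, sub_neg_eq_add, add_neg_cancel, hA0, hA1]
  ring

theorem eq_primitive (ha : 0 < a) {g D : ℝ → ℂ} (hD : Continuous D)
    (hg : ∀ x ∈ Icc (-a) a, HasDerivWithinAt g (D x) (Icc (-a) a) x) :
    EqOn g (fun x => g 0 + ∫ s in (0 : ℝ)..x, D s) (Icc (-a) a) := by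
  intro x hx
  have h0 : (0 : ℝ) ∈ Icc (-a) a := ⟨by linarith, ha.le⟩
  have hsub : uIcc 0 x ⊆ Icc (-a) a := uIcc_subset_Icc h0 hx
  simp only
  rw [intervalIntegral.integral_eq_sub_of_hasDeriv_right
    (fun y hy => (hg y (hsub hy)).continuousWithinAt.mono hsub) (fun y hy => ?_)
    (hD.intervalIntegrable _ _)]
  · ring
  · have hy' : y ∈ uIcc 0 x := ⟨hy.1.le, hy.2.le⟩
    refine ((hg y (hsub hy')).hasDerivAt ?_).hasDerivWithinAt
    refine Filter.mem_of_superset (Ioo_mem_nhds hy.1 hy.2) fun z hz => hsub ⟨hz.1.le, hz.2.le⟩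

theorem hasDerivAt_primitive {D : ℝ → ℂ} (hD : Continuous D) (c : ℂ) (x : ℝ) :
    HasDerivAt (fun x => c + ∫ s in (0 : ℝ)..x, D s) (D x) x :=
  (intervalIntegral.integral_hasDerivAt_right (hD.intervalIntegrable _ _)
    (hD.stronglyMeasurableAtFilter _ _) hD.continuousAt).const_add c

/-- At points of [-a, a] the operator sees only values on [-a, a], so u may be replaced by the
primitive of u', which is C¹ on the whole line. -/
theorem hasDerivWithinAt_volterra (ha : 0 < a) (hp : IsBoundedC1 p p' C)
    (hSp : IsSwapSolution p (fun x => p x / 2) Sp)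
    (hSm : IsSwapSolution (fun x => -p x) (fun x => -p x / 2) Sm) {u u' : ℝ → ℂ}
    (hu : ∀ x ∈ Icc (-a) a, HasDerivWithinAt u (u' x) (Icc (-a) a) x) (hu' : Continuous u')
    {x : ℝ} (hx : x ∈ Icc (-a) a) :
    HasDerivWithinAt (volterra (dressKernel Sp Sm) u)
      (p x * volterra (dressKernel Sp Sm) u x + volterra (dressKernel Sm Sp) u' x)
      (Icc (-a) a) x := by
  have heq := eq_primitive ha hu' hu
  rw [volterra_congr heq hx]
  exact (hasDerivAt_volterra hp hSp hSm (hasDerivAt_primitive hu' _) hu' x).hasDerivWithinAt.congr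
    (fun y hy => volterra_congr heq hy) (volterra_congr heq hx)

/-- The swap equations live on the whole plane with a bounded coefficient. The derivative is
extended by constants and integrated; a bump equal to 1 on [-a, a] then provides boundedness. -/
theorem exists_extension (ha : 0 < a) {g : ℝ → ℂ} (hg : ContDiffOn ℝ 1 g (Icc (-a) a)) :
    ∃ p p' C, IsBoundedC1 p p' C ∧ EqOn p g (Icc (-a) a) := by
  have hle : -a ≤ a := by linarith
  have hud : UniqueDiffOn ℝ (Icc (-a) a) := uniqueDiffOn_Icc (by linarith)
  have hdc : ContinuousOn (derivWithin g (Icc (-a) a)) (Icc (-a) a) :=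
    hg.continuousOn_derivWithin hud le_rfl
  set D : ℝ → ℂ := IccExtend hle ((Icc (-a) a).domRestrict (derivWithin g (Icc (-a) a))) with hDdef
  have hD : Continuous D := (continuousOn_iff_continuous_domRestrict.1 hdc).Icc_extend'
  have heq := eq_primitive ha hD fun x hx => by
    rw [hDdef, IccExtend_of_mem _ _ hx]
    exact ((hg.differentiableOn one_ne_zero) x hx).hasDerivWithinAt
  set P : ℝ → ℂ := fun x => g 0 + ∫ s in (0 : ℝ)..x, D s with hP
  have hPd : ∀ x, HasDerivAt P (D x) x := hasDerivAt_primitive hD _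
  have hPc : ContDiff ℝ 1 P := by
    rw [contDiff_one_iff_deriv]
    refine ⟨fun x => (hPd x).differentiableAt, ?_⟩
    rwa [show deriv P = D from funext fun x => (hPd x).deriv]
  let χ : ContDiffBump (0 : ℝ) := ⟨a, a + 1, ha, by linarith⟩
  have hχ : ContDiff ℝ 1 fun x => χ x • P x := χ.contDiff.smul hPc
  obtain ⟨M, hM⟩ := hχ.continuous.bounded_above_of_compact_support
    (χ.hasCompactSupport.smul_right (f' := P))
  refine ⟨fun x => χ x • P x, deriv fun x => χ x • P x, max M 1,
    ⟨fun x => (hχ.differentiable one_ne_zero x).hasDerivAt, hχ.continuous_deriv le_rfl,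
      by positivity, fun x => (hM x).trans (le_max_left _ _)⟩, fun x hx => ?_⟩
  have h1 : χ x = 1 := χ.one_of_mem_closedBall (by
    rw [Metric.mem_closedBall, dist_zero_right]
    exact abs_le.2 hx)
  simp only [h1, one_smul]
  exact (heq hx).symm

theorem toLine_apply (ha : 0 < a) (u : C(Icc (-a) a, ℂ)) {x : ℝ} (hx : x ∈ Icc (-a) a) :
    toLine ha u x = u ⟨x, hx⟩ :=
  IccExtend_of_mem _ _ hx

theorem continuous_toLine (ha : 0 < a) (u : C(Icc (-a) a, ℂ)) : Continuous (toLine ha u) :=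
  u.continuous.Icc_extend'

/-- 1 - (-y)^n is (1 + y) times a geometric sum commuting with it, and evenness removes the sign. -/
theorem isUnit_one_add_of_norm_pow_lt_one {R : Type*} [NormedRing R] [HasSummableGeomSeries R]
    {y : R} {n : ℕ} (h : ‖y ^ n‖ < 1) (hn : Even n) : IsUnit (1 + y) := by
  have h1 : IsUnit (1 - (-y) ^ n) := isUnit_one_sub_of_norm_lt_one (by rwa [hn.neg_pow])
  rw [← mul_neg_geom_sum, sub_neg_eq_add] at h1
  refine ((Commute.isUnit_mul_iff ?_).1 h1).1
  refine Commute.sum_right _ _ _ fun i _ => ?_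
  exact ((Commute.one_left _).add_left (Commute.refl y).neg_right.symm.symm).pow_right i

theorem exists_volterra_equiv (ha : 0 < a) {A : ℝ × ℝ → ℂ} (hA : Continuous A) :
    ∃ T : C(Icc (-a) a, ℂ) ≃L[ℂ] C(Icc (-a) a, ℂ),
      ∀ u (x : Icc (-a) a), T u x = volterra A (toLine ha u) x := by
  set k : ℝ × ℝ → ℂ := fun z => A ((z.1 + z.2) / 2, (z.1 - z.2) / 2) with hk
  have hkc : Continuous k := by fun_prop
  obtain ⟨M₀, hM₀⟩ := (isCompact_Icc.prod isCompact_Icc : IsCompact (Icc (-a) a ×ˢ Icc (-a) a))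
    |>.exists_bound_of_continuousOn hkc.continuousOn
  set M := max M₀ 1 with hMdef
  have hM : ∀ x ∈ Icc (-a) a, ∀ t ∈ Icc (-a) a, ‖k (x, t)‖ ≤ M := fun x hx t ht =>
    (hM₀ (x, t) ⟨hx, ht⟩).trans (le_max_left _ _)
  have hMp : 0 < M := by positivity
  have hcont : ∀ u : C(Icc (-a) a, ℂ), Continuous fun x : ℝ =>
      ∫ t in (-x)..x, k (x, t) * toLine ha u t := by
    intro u
    have huc := continuous_toLine ha u
    have h1 : Continuous fun z : ℝ × ℝ => ∫ t in (0 : ℝ)..z.1, k (z.2, t) * toLine ha u t :=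
      continuous_primitive_fst (g := fun z => k (z.2, z.1) * toLine ha u z.1) (by fun_prop)
    have h2 : (fun x : ℝ => ∫ t in (-x)..x, k (x, t) * toLine ha u t) = fun x =>
        (∫ t in (0 : ℝ)..x, k (x, t) * toLine ha u t) -
          ∫ t in (0 : ℝ)..(-x), k (x, t) * toLine ha u t := by
      funext x
      have hc : Continuous fun t => k (x, t) * toLine ha u t := by fun_prop
      exact (intervalIntegral.integral_interval_sub_left (hc.intervalIntegrable _ _)
        (hc.intervalIntegrable _ _)).symm
    rw [h2]
    exact (h1.comp (by fun_prop : Continuous fun x : ℝ => (x, x))).sub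
      (h1.comp (by fun_prop : Continuous fun x : ℝ => (-x, x)))
  -- The integrals over [0, x] and [0, -x] each contribute M/(4M) = 1/4, so the weighted bound
  -- halves at every application.
  have hbound : ∀ (u : C(Icc (-a) a, ℂ)) (c : ℝ), 0 ≤ c →
      (∀ x : Icc (-a) a, ‖u x‖ ≤ c * Real.exp (4 * M * |(x : ℝ)|)) → ∀ x ∈ Icc (-a) a,
      ‖∫ t in (-x)..x, k (x, t) * toLine ha u t‖ ≤ c / 2 * Real.exp (4 * M * |x|) := by
    intro u c hc hu x hx
    have huc := continuous_toLine ha u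
    have hcc : Continuous fun t => k (x, t) * toLine ha u t := by fun_prop
    have hx' : -x ∈ Icc (-a) a := ⟨by linarith [hx.2], by linarith [hx.1]⟩
    have h0 : (0 : ℝ) ∈ Icc (-a) a := ⟨by linarith, ha.le⟩
    have hone : ∀ y ∈ Icc (-a) a, ‖∫ t in (0 : ℝ)..y, k (x, t) * toLine ha u t‖ ≤
        M * c / (4 * M) * Real.exp (4 * M * |y|) := fun y hy =>
      norm_integral_le_exp (by positivity) (by positivity) y fun t ht => by
        have ht' := uIcc_subset_Icc h0 hy ht
        rw [norm_mul, mul_assoc, toLine_apply ha u ht']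
        exact mul_le_mul (hM x hx t ht') (hu ⟨t, ht'⟩) (norm_nonneg _) hMp.le
    rw [← intervalIntegral.integral_interval_sub_left (hcc.intervalIntegrable 0 x)
      (hcc.intervalIntegrable 0 (-x))]
    have h1 := hone x hx
    have h2 := hone (-x) hx'
    rw [abs_neg] at h2
    refine ((norm_sub_le _ _).trans (add_le_add h1 h2)).trans (le_of_eq ?_)
    field_simp
    ring
  have hexp : ∀ x : Icc (-a) a, Real.exp (4 * M * |(x : ℝ)|) ≤ Real.exp (4 * M * a) := fun x =>
    Real.exp_le_exp.2 (mul_le_mul_of_nonneg_left (abs_le.2 x.2) (by positivity))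
  have hone : ∀ x : Icc (-a) a, 1 ≤ Real.exp (4 * M * |(x : ℝ)|) := fun x =>
    Real.one_le_exp (by positivity)
  have hstart : ∀ (u : C(Icc (-a) a, ℂ)) (x : Icc (-a) a),
      ‖u x‖ ≤ ‖u‖ * Real.exp (4 * M * |(x : ℝ)|) := fun u x =>
    (u.norm_coe_le_norm x).trans (le_mul_of_one_le_right (norm_nonneg _) (hone x))
  let V₀ : C(Icc (-a) a, ℂ) →ₗ[ℂ] C(Icc (-a) a, ℂ) :=
    { toFun := fun u => ⟨fun x => ∫ t in (-(x : ℝ))..x, k (x, t) * toLine ha u t,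
        (hcont u).comp continuous_subtype_val⟩
      map_add' := fun u v => by
        ext x
        have huc := continuous_toLine ha u
        have hvc := continuous_toLine ha v
        simp only [ContinuousMap.coe_mk, ContinuousMap.add_apply]
        rw [← intervalIntegral.integral_add
          ((by fun_prop : Continuous fun t => k (x, t) * toLine ha u t).intervalIntegrable _ _)
          ((by fun_prop : Continuous fun t => k (x, t) * toLine ha v t).intervalIntegrable _ _)]
        simp only [← mul_add]
        rfl
      map_smul' := fun c u => by
        ext x
        simp only [ContinuousMap.coe_mk, ContinuousMap.smul_apply, RingHom.id_apply, smul_eq_mul]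
        rw [← intervalIntegral.integral_const_mul]
        refine intervalIntegral.integral_congr fun t _ => ?_
        simp only [mul_left_comm c]
        rfl }
  have hV₀ : ∀ u (x : Icc (-a) a), V₀ u x = ∫ t in (-(x : ℝ))..x, k (x, t) * toLine ha u t :=
    fun u x => rfl
  obtain ⟨V, hV⟩ : ∃ V : C(Icc (-a) a, ℂ) →L[ℂ] C(Icc (-a) a, ℂ), ∀ u (x : Icc (-a) a),
      V u x = ∫ t in (-(x : ℝ))..x, k (x, t) * toLine ha u t := by
    refine ⟨V₀.mkContinuous (1 / 2 * Real.exp (4 * M * a)) fun u => ?_, hV₀⟩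
    rw [ContinuousMap.norm_le _ (by positivity)]
    intro x
    rw [hV₀]
    refine (hbound u ‖u‖ (norm_nonneg _) (hstart u) x x.2).trans ?_
    nlinarith [hexp x, norm_nonneg u]
  clear_value V₀
  have hpow : ∀ (n : ℕ) (u : C(Icc (-a) a, ℂ)) (x : Icc (-a) a),
      ‖(V ^ n) u x‖ ≤ (1 / 2) ^ n * ‖u‖ * Real.exp (4 * M * |(x : ℝ)|) := by
    intro n u
    induction n with
    | zero => simpa using hstart u
    | succ n ih =>
      intro x
      rw [pow_succ', mul_apply_eq_comp, hV]
      refine (hbound _ _ (by positivity) ih x x.2).trans (le_of_eq ?_)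
      ring
  -- The n-th power has norm at most 2^{-n} exp(4Ma), the exponential being the cost of returning to
  -- the uniform norm. Below, n is doubled to have an even exponent.
  obtain ⟨n, hn⟩ := exists_pow_lt_of_lt_one (Real.exp_pos (-(4 * M * a)))
    (show (1 / 2 : ℝ) < 1 by norm_num)
  have hlt : ‖V ^ (2 * n)‖ < 1 := by
    have h1 : ‖V ^ (2 * n)‖ ≤ (1 / 2) ^ (2 * n) * Real.exp (4 * M * a) := by
      refine ContinuousLinearMap.opNorm_le_bound _ (by positivity) fun u => ?_
      rw [ContinuousMap.norm_le _ (by positivity)]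
      intro x
      refine (hpow _ u x).trans ?_
      rw [mul_right_comm]
      exact mul_le_mul_of_nonneg_right
        (mul_le_mul_of_nonneg_left (hexp x) (by positivity)) (norm_nonneg _)
    have h2 : (1 / 2 : ℝ) ^ (2 * n) ≤ (1 / 2) ^ n :=
      pow_le_pow_of_le_one (by norm_num) (by norm_num) (by omega)
    refine h1.trans_lt ?_
    calc _ < Real.exp (-(4 * M * a)) * Real.exp (4 * M * a) :=
          mul_lt_mul_of_pos_right (h2.trans_lt hn) (Real.exp_pos _)
      _ = 1 := by rw [← Real.exp_add]; simp
  obtain ⟨U, hU⟩ := isUnit_one_add_of_norm_pow_lt_one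
    (R := C(Icc (-a) a, ℂ) →L[ℂ] C(Icc (-a) a, ℂ)) hlt (even_two_mul n)
  refine ⟨ContinuousLinearEquiv.unitsEquiv ℂ _ U, fun u x => ?_⟩
  have : ContinuousLinearEquiv.unitsEquiv ℂ _ U u = (U : C(Icc (-a) a, ℂ) →L[ℂ] C(Icc (-a) a, ℂ)) u :=
    rfl
  rw [this, hU, _root_.add_apply, ContinuousMap.add_apply, hV, volterra,
    toLine_apply ha u x.2]
  rfl

end

/-! ### The potentials, the free system and the Dirac system. -/

section

variable {a m : ℝ} {p p' S : ℝ → ℂ} {C : ℝ} {Sp Sm : ℝ × ℝ → ℂ} {E : ℂ}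

theorem derivWithin_diracF (hp : IsBoundedC1 p p' C) (ha : 0 < a)
    (hpS : EqOn p (fun x => -((m : ℂ) + S x)) (Icc (-a) a)) :
    diracF m S 0 = 1 ∧ (∀ x, diracF m S x ≠ 0) ∧
    (∀ x ∈ Icc (-a) a, derivWithin (diracF m S) (Icc (-a) a) x = p x * diracF m S x) ∧
    ∀ x ∈ Icc (-a) a, derivWithin (derivWithin (diracF m S) (Icc (-a) a)) (Icc (-a) a) x =
      (p' x + p x ^ 2) * diracF m S x := by
  have hud : UniqueDiffOn ℝ (Icc (-a) a) := uniqueDiffOn_Icc (by linarith)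
  set F : ℝ → ℂ := fun x => Complex.exp (-∫ s in (0 : ℝ)..x, -p s)
  have hF : ∀ x, HasDerivAt F (p x * F x) x := fun x => by
    simpa only [neg_neg] using hasDerivAt_exp_neg_integral hp.neg.cont x
  have hfF : EqOn (diracF m S) F (Icc (-a) a) := by
    intro x hx
    simp only [diracF, F]
    congr 2
    refine intervalIntegral.integral_congr fun s hs => ?_
    simp only [hpS (abs_le.1 ((abs_le_of_mem_uIcc_zero hs).trans (abs_le.2 hx))), neg_neg]
  have h1 : ∀ x ∈ Icc (-a) a,
      derivWithin (diracF m S) (Icc (-a) a) x = p x * diracF m S x := fun x hx => by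
    rw [hfF hx]
    exact ((hF x).hasDerivWithinAt.congr hfF (hfF hx)).derivWithin (hud x hx)
  refine ⟨by simp [diracF], fun x => Complex.exp_ne_zero _, h1, fun x hx => ?_⟩
  have h2 : EqOn (derivWithin (diracF m S) (Icc (-a) a)) (fun x => p x * F x) (Icc (-a) a) :=
    fun y hy => by rw [h1 y hy, hfF hy]
  rw [(((hp.hasDerivAt x).mul (hF x)).hasDerivWithinAt.congr h2 (h2 hx)).derivWithin (hud x hx),
    hfF hx]
  ring

/-- Since f' = pf, f'' = (p' + p²) f. The square is kept as `(-p x) ^ 2` so that the second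
potential is literally the first one for -p. -/
theorem potential_eqOn (hp : IsBoundedC1 p p' C) (ha : 0 < a)
    (hpS : EqOn p (fun x => -((m : ℂ) + S x)) (Icc (-a) a)) :
    EqOn (potential a (diracF m S)) (fun x => p' x + p x ^ 2) (Icc (-a) a) ∧
    EqOn (darbouxPotential a (diracF m S)) (fun x => -p' x + (-p x) ^ 2) (Icc (-a) a) := by
  obtain ⟨-, h0, h1, h2⟩ := derivWithin_diracF hp ha hpS
  have hq : EqOn (potential a (diracF m S)) (fun x => p' x + p x ^ 2) (Icc (-a) a) := fun x hx => by
    rw [potential, h2 x hx, mul_div_cancel_right₀ _ (h0 x)]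
  refine ⟨hq, fun x hx => ?_⟩
  rw [darbouxPotential, hq hx, h1 x hx, mul_div_cancel_right₀ _ (h0 x)]
  ring

theorem IsFreeSolution.hasDerivWithinAt {u₁ u₂ : ℝ → ℂ} (h : IsFreeSolution a E u₁ u₂) {x : ℝ}
    (hx : x ∈ Icc (-a) a) :
    HasDerivWithinAt u₁ (E * u₂ x) (Icc (-a) a) x ∧
      HasDerivWithinAt u₂ (-E * u₁ x) (Icc (-a) a) x :=
  ⟨h.eq₁ x hx ▸ (h.diff₁ x hx).hasDerivWithinAt, h.eq₂ x hx ▸ (h.diff₂ x hx).hasDerivWithinAt⟩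

theorem isFreeSolution_of_hasDerivWithinAt (ha : 0 < a) {u₁ u₂ : ℝ → ℂ}
    (h₁ : ∀ x ∈ Icc (-a) a, HasDerivWithinAt u₁ (E * u₂ x) (Icc (-a) a) x)
    (h₂ : ∀ x ∈ Icc (-a) a, HasDerivWithinAt u₂ (-E * u₁ x) (Icc (-a) a) x) :
    IsFreeSolution a E u₁ u₂ :=
  have hud : UniqueDiffOn ℝ (Icc (-a) a) := uniqueDiffOn_Icc (by linarith)
  ⟨fun x hx => (h₁ x hx).differentiableWithinAt, fun x hx => (h₂ x hx).differentiableWithinAt,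
    fun x hx => (h₁ x hx).derivWithin (hud x hx), fun x hx => (h₂ x hx).derivWithin (hud x hx)⟩

theorem IsDiracSolution.hasDerivWithinAt (hpS : EqOn p (fun x => -((m : ℂ) + S x)) (Icc (-a) a))
    {ψ₁ ψ₂ : ℝ → ℂ} (h : IsDiracSolution a m S E ψ₁ ψ₂) {x : ℝ} (hx : x ∈ Icc (-a) a) :
    HasDerivWithinAt ψ₁ (p x * ψ₁ x + E * ψ₂ x) (Icc (-a) a) x ∧
      HasDerivWithinAt ψ₂ (-p x * ψ₂ x - E * ψ₁ x) (Icc (-a) a) x := by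
  have e₁ : derivWithin ψ₁ (Icc (-a) a) x = p x * ψ₁ x + E * ψ₂ x := by
    rw [hpS hx]
    linear_combination h.eq₁ x hx
  have e₂ : derivWithin ψ₂ (Icc (-a) a) x = -p x * ψ₂ x - E * ψ₁ x := by
    rw [hpS hx]
    linear_combination -h.eq₂ x hx
  exact ⟨e₁ ▸ (h.diff₁ x hx).hasDerivWithinAt, e₂ ▸ (h.diff₂ x hx).hasDerivWithinAt⟩

theorem isDiracSolution_of_hasDerivWithinAt (ha : 0 < a)
    (hpS : EqOn p (fun x => -((m : ℂ) + S x)) (Icc (-a) a)) {ψ₁ ψ₂ : ℝ → ℂ}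
    (h₁ : ∀ x ∈ Icc (-a) a, HasDerivWithinAt ψ₁ (p x * ψ₁ x + E * ψ₂ x) (Icc (-a) a) x)
    (h₂ : ∀ x ∈ Icc (-a) a, HasDerivWithinAt ψ₂ (-p x * ψ₂ x - E * ψ₁ x) (Icc (-a) a) x) :
    IsDiracSolution a m S E ψ₁ ψ₂ := by
  have hud : UniqueDiffOn ℝ (Icc (-a) a) := uniqueDiffOn_Icc (by linarith)
  refine ⟨fun x hx => (h₁ x hx).differentiableWithinAt,
    fun x hx => (h₂ x hx).differentiableWithinAt, fun x hx => ?_, fun x hx => ?_⟩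
  · rw [(h₁ x hx).derivWithin (hud x hx), hpS hx]
    ring
  · rw [(h₂ x hx).derivWithin (hud x hx), hpS hx]
    ring

/-- A linear system with Lipschitz constant C + ‖E‖, so the initial values at the interior point 0
determine the solution on both sides. -/
theorem IsDiracSolution.unique (ha : 0 < a) (hp : IsBoundedC1 p p' C)
    (hpS : EqOn p (fun x => -((m : ℂ) + S x)) (Icc (-a) a)) {ψ₁ ψ₂ χ₁ χ₂ : ℝ → ℂ}
    (h : IsDiracSolution a m S E ψ₁ ψ₂) (h' : IsDiracSolution a m S E χ₁ χ₂)
    (h₁ : ψ₁ 0 = χ₁ 0) (h₂ : ψ₂ 0 = χ₂ 0) :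
    EqOn ψ₁ χ₁ (Icc (-a) a) ∧ EqOn ψ₂ χ₂ (Icc (-a) a) := by
  have hd : ∀ {ψ₁ ψ₂ : ℝ → ℂ}, IsDiracSolution a m S E ψ₁ ψ₂ → ∀ t ∈ Ioo (-a) a,
      HasDerivAt (fun t => (ψ₁ t, ψ₂ t)) (p t * ψ₁ t + E * ψ₂ t, -p t * ψ₂ t - E * ψ₁ t) t :=
    fun h t ht => by
      have hn := Icc_mem_nhds ht.1 ht.2
      have := h.hasDerivWithinAt hpS (Ioo_subset_Icc_self ht)
      exact (this.1.hasDerivAt hn).prodMk (this.2.hasDerivAt hn)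
  have hlip : ∀ t ∈ Ioo (-a) a, LipschitzOnWith (Real.toNNReal (C + ‖E‖))
      (fun y : ℂ × ℂ => (p t * y.1 + E * y.2, -p t * y.2 - E * y.1)) univ := by
    intro t _
    refine LipschitzOnWith.of_dist_le_mul fun y _ z _ => ?_
    have hC : 0 ≤ C + ‖E‖ := add_nonneg hp.pos.le (norm_nonneg _)
    have hy1 : ‖y.1 - z.1‖ ≤ ‖y - z‖ := norm_fst_le (y - z)
    have hy2 : ‖y.2 - z.2‖ ≤ ‖y - z‖ := norm_snd_le (y - z)
    rw [Real.coe_toNNReal _ hC, dist_eq_norm, dist_eq_norm, Prod.norm_def]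
    refine max_le ?_ ?_
    · calc ‖p t * y.1 + E * y.2 - (p t * z.1 + E * z.2)‖
          = ‖p t * (y.1 - z.1) + E * (y.2 - z.2)‖ := by ring_nf
        _ ≤ ‖p t‖ * ‖y.1 - z.1‖ + ‖E‖ * ‖y.2 - z.2‖ := by
          simpa only [norm_mul] using norm_add_le (p t * (y.1 - z.1)) (E * (y.2 - z.2))
        _ ≤ C * ‖y - z‖ + ‖E‖ * ‖y - z‖ := by
          gcongr
          · exact hp.pos.le
          · exact hp.bound t
        _ = _ := by ring
    · calc ‖-p t * y.2 - E * y.1 - (-p t * z.2 - E * z.1)‖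
          = ‖-(p t * (y.2 - z.2) + E * (y.1 - z.1))‖ := by ring_nf
        _ ≤ ‖p t‖ * ‖y.2 - z.2‖ + ‖E‖ * ‖y.1 - z.1‖ := by
          simpa only [norm_mul, norm_neg] using norm_add_le (p t * (y.2 - z.2)) (E * (y.1 - z.1))
        _ ≤ C * ‖y - z‖ + ‖E‖ * ‖y - z‖ := by
          gcongr
          · exact hp.pos.le
          · exact hp.bound t
        _ = _ := by ring
  have := ODE_solution_unique_of_mem_Icc (f := fun t => (ψ₁ t, ψ₂ t)) (g := fun t => (χ₁ t, χ₂ t))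
    (v := fun t y => (p t * y.1 + E * y.2, -p t * y.2 - E * y.1)) (s := fun _ => univ) (t₀ := 0)
    hlip ⟨by linarith, ha⟩ (h.diff₁.continuousOn.prodMk h.diff₂.continuousOn) (hd h)
    (fun _ _ => mem_univ _) (h'.diff₁.continuousOn.prodMk h'.diff₂.continuousOn) (hd h')
    (fun _ _ => mem_univ _) (Prod.ext h₁ h₂)
  exact ⟨fun x hx => congrArg Prod.fst (this hx), fun x hx => congrArg Prod.snd (this hx)⟩

theorem exists_isFreeSolution (ha : 0 < a) (E c₁ c₂ : ℂ) :
    ∃ w₁ w₂ : C(Icc (-a) a, ℂ), IsFreeSolution a E (toLine ha w₁) (toLine ha w₂) ∧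
      toLine ha w₁ 0 = c₁ ∧ toLine ha w₂ 0 = c₂ := by
  set f₁ : ℝ → ℂ := fun x => c₁ * Complex.cos (E * x) + c₂ * Complex.sin (E * x) with hf₁
  set f₂ : ℝ → ℂ := fun x => c₂ * Complex.cos (E * x) - c₁ * Complex.sin (E * x) with hf₂
  have hx (x : ℝ) : HasDerivAt (fun x : ℝ => E * (x : ℂ)) E x := by
    simpa using (Complex.ofRealCLM.hasDerivAt (x := x)).const_mul E
  have h₁ (x : ℝ) : HasDerivAt f₁ (E * f₂ x) x := by
    have := (((Complex.hasDerivAt_cos (E * x)).comp x (hx x)).const_mul c₁).add (((Complex.hasDerivAt_sin (E * x)).comp x (hx x)).const_mul c₂)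
    convert! this using 1
    simp only [hf₂]
    ring
  have h₂ (x : ℝ) : HasDerivAt f₂ (-E * f₁ x) x := by
    have := (((Complex.hasDerivAt_cos (E * x)).comp x (hx x)).const_mul c₂).sub (((Complex.hasDerivAt_sin (E * x)).comp x (hx x)).const_mul c₁)
    convert! this using 1
    simp only [hf₁]
    ring
  have e (f : ℝ → ℂ) (hf : Continuous f) :
      EqOn (toLine ha ⟨fun x => f x, hf.comp continuous_subtype_val⟩) f (Icc (-a) a) :=
    fun x hx => toLine_apply ha _ hx
  have hc₁ : Continuous f₁ := by fun_prop
  have hc₂ : Continuous f₂ := by fun_prop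
  have h0 : (0 : ℝ) ∈ Icc (-a) a := ⟨by linarith, ha.le⟩
  refine ⟨_, _, isFreeSolution_of_hasDerivWithinAt ha (fun x hx => ?_) (fun x hx => ?_),
    (e f₁ hc₁ h0).trans (by simp [hf₁]), (e f₂ hc₂ h0).trans (by simp [hf₂])⟩
  · rw [e f₂ hc₂ hx]
    exact (h₁ x).hasDerivWithinAt.congr (e f₁ hc₁) (e f₁ hc₁ hx)
  · rw [e f₁ hc₁ hx]
    exact (h₂ x).hasDerivWithinAt.congr (e f₂ hc₂) (e f₂ hc₂ hx)

theorem volterra_const_mul (A : ℝ × ℝ → ℂ) (c : ℂ) (u : ℝ → ℂ) (x : ℝ) :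
    volterra A (fun t => c * u t) x = c * volterra A u x := by
  simp only [volterra, mul_add, mul_left_comm _ c, intervalIntegral.integral_const_mul]

theorem IsFreeSolution.isDiracSolution (ha : 0 < a) (hp : IsBoundedC1 p p' C)
    (hpS : EqOn p (fun x => -((m : ℂ) + S x)) (Icc (-a) a))
    (hSp : IsSwapSolution p (fun x => p x / 2) Sp)
    (hSm : IsSwapSolution (fun x => -p x) (fun x => -p x / 2) Sm) {u₁ u₂ ψ₁ ψ₂ : ℝ → ℂ}
    (hu₁ : Continuous u₁) (hu₂ : Continuous u₂)
    (hψ₁ : EqOn ψ₁ (volterra (dressKernel Sp Sm) u₁) (Icc (-a) a))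
    (hψ₂ : EqOn ψ₂ (volterra (dressKernel Sm Sp) u₂) (Icc (-a) a))
    (h : IsFreeSolution a E u₁ u₂) : IsDiracSolution a m S E ψ₁ ψ₂ := by
  have hSp' : IsSwapSolution (fun x => - -p x) (fun x => - -p x / 2) Sp := by
    simpa only [neg_neg] using hSp
  refine isDiracSolution_of_hasDerivWithinAt ha hpS (fun x hx => ?_) (fun x hx => ?_)
  · have := (hasDerivWithinAt_volterra ha hp hSp hSm (fun x hx => (h.hasDerivWithinAt hx).1)
      (by fun_prop) hx).congr hψ₁ (hψ₁ hx)
    rwa [volterra_const_mul, ← hψ₁ hx, ← hψ₂ hx] at this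
  · have := (hasDerivWithinAt_volterra ha hp.neg hSm hSp' (fun x hx => (h.hasDerivWithinAt hx).2)
      (by fun_prop) hx).congr hψ₂ (hψ₂ hx)
    rwa [volterra_const_mul, ← hψ₁ hx, ← hψ₂ hx, neg_mul E, ← sub_eq_add_neg] at this

theorem transmutation_eqOn {q : ℝ → ℂ} {h : ℂ} {A : ℝ × ℝ → ℂ}
    (hk : ∀ x ∈ Icc (-a) a, ∀ t ∈ Icc (-a) a, kernelH a q h x t = A ((x + t) / 2, (x - t) / 2))
    (u : ℝ → ℂ) {x : ℝ} (hx : x ∈ Icc (-a) a) : transmutation a q h u x = volterra A u x := by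
  rw [transmutation, volterra]
  congr 1
  refine intervalIntegral.integral_congr fun t ht => ?_
  simp only [hk x hx t (uIcc_subset_Icc ⟨by linarith [hx.2], by linarith [hx.1]⟩ hx ht)]

theorem volterra_zero (A : ℝ × ℝ → ℂ) (u : ℝ → ℂ) : volterra A u 0 = u 0 := by
  simp [volterra]

end

end DiracTransmutation

/-! ### Assembly of the theorem. -/

open DiracTransmutation

theorem mainTheorem7 (a : ℝ) (ha : 0 < a) (m : ℝ) (hm : 0 < m) (S : ℝ → ℂ)
    (hS : ContDiffOn ℝ 1 S (Set.Icc (-a) a)) :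
    let f : ℝ → ℂ := DiracTransmutation.diracF m S
    let q₁ : ℝ → ℂ := DiracTransmutation.potential a f
    let q₂ : ℝ → ℂ := DiracTransmutation.darbouxPotential a f
    let h : ℂ := derivWithin f (Set.Icc (-a) a) 0
    let ι : C(Set.Icc (-a) a, ℂ) → ℝ → ℂ := DiracTransmutation.toLine ha
    -- the Goursat problems that define the two kernels are solvable
    DiracTransmutation.IsGoursatSolution a q₁ (DiracTransmutation.goursatSolution a q₁) ∧
    DiracTransmutation.IsGoursatSolution a q₂ (DiracTransmutation.goursatSolution a q₂) ∧
    -- the Volterra operators are continuous and continuously invertible on `C[-a, a]`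
    ∃ T₁ T₂ : C(Set.Icc (-a) a, ℂ) ≃L[ℂ] C(Set.Icc (-a) a, ℂ),
      (∀ (u : C(Set.Icc (-a) a, ℂ)) (x : Set.Icc (-a) a),
        T₁ u x = DiracTransmutation.transmutation a q₁ h (ι u) x) ∧
      (∀ (u : C(Set.Icc (-a) a, ℂ)) (x : Set.Icc (-a) a),
        T₂ u x = DiracTransmutation.transmutation a q₂ (-h) (ι u) x) ∧
      ∀ E : ℂ,
        (∀ u₁ u₂ : C(Set.Icc (-a) a, ℂ),
          DiracTransmutation.IsFreeSolution a E (ι u₁) (ι u₂) →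
            DiracTransmutation.IsDiracSolution a m S E (ι (T₁ u₁)) (ι (T₂ u₂)) ∧
            ι (T₁ u₁) 0 = ι u₁ 0 ∧ ι (T₂ u₂) 0 = ι u₂ 0) ∧
        (∀ ψ₁ ψ₂ : C(Set.Icc (-a) a, ℂ),
          DiracTransmutation.IsDiracSolution a m S E (ι ψ₁) (ι ψ₂) →
            DiracTransmutation.IsFreeSolution a E (ι (T₁.symm ψ₁)) (ι (T₂.symm ψ₂)) ∧
            ι (T₁.symm ψ₁) 0 = ι ψ₁ 0 ∧ ι (T₂.symm ψ₂) 0 = ι ψ₂ 0) := by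
  intro f q₁ q₂ h ι
  obtain ⟨p, p', C, hp, hpS⟩ := exists_extension (g := fun x => -((m : ℂ) + S x)) ha
    (contDiffOn_const.add hS).neg
  have h0 : (0 : ℝ) ∈ Icc (-a) a := ⟨by linarith, ha.le⟩
  obtain ⟨hf0, -, hf1, -⟩ := derivWithin_diracF hp ha hpS
  obtain ⟨hq₁, hq₂⟩ := potential_eqOn hp ha hpS
  have hh : h = p 0 := by rw [← mul_one (p 0), ← hf0]; exact hf1 0 h0
  obtain ⟨Sp, hSp⟩ := hp.exists_half
  obtain ⟨Sm, hSm⟩ := hp.neg.exists_half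
  have hSp' : IsSwapSolution (fun x => - -p x) (fun x => - -p x / 2) Sp := by
    simpa only [neg_neg] using hSp
  obtain ⟨hG₁, hk₁⟩ := goursatSolution_spec ha hp hSp hSm hq₁
  obtain ⟨hG₂, hk₂⟩ := goursatSolution_spec ha hp.neg hSm hSp' hq₂
  rw [← hh] at hk₁ hk₂
  have hc (Sp Sm : ℝ × ℝ → ℂ) (h₁ : Continuous Sp) (h₂ : Continuous Sm) :
      Continuous (dressKernel Sp Sm) := by
    unfold dressKernel Prod.swap
    fun_prop
  obtain ⟨T₁, hT₁⟩ := exists_volterra_equiv ha (hc Sp Sm hSp.cont hSm.cont)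
  obtain ⟨T₂, hT₂⟩ := exists_volterra_equiv ha (hc Sm Sp hSm.cont hSp.cont)
  have hι₁ : ∀ u, EqOn (ι (T₁ u)) (volterra (dressKernel Sp Sm) (ι u)) (Icc (-a) a) :=
    fun u x hx => (toLine_apply ha _ hx).trans (hT₁ u ⟨x, hx⟩)
  have hι₂ : ∀ u, EqOn (ι (T₂ u)) (volterra (dressKernel Sm Sp) (ι u)) (Icc (-a) a) :=
    fun u x hx => (toLine_apply ha _ hx).trans (hT₂ u ⟨x, hx⟩)
  have hz₁ : ∀ u, ι (T₁ u) 0 = ι u 0 := fun u => (hι₁ u h0).trans (volterra_zero _ _)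
  have hz₂ : ∀ u, ι (T₂ u) 0 = ι u 0 := fun u => (hι₂ u h0).trans (volterra_zero _ _)
  refine ⟨hG₁, hG₂, T₁, T₂, fun u x => (hT₁ u x).trans (transmutation_eqOn hk₁ _ x.2).symm,
    fun u x => (hT₂ u x).trans (transmutation_eqOn hk₂ _ x.2).symm, fun E => ?_⟩
  have hforward : ∀ u₁ u₂ : C(Icc (-a) a, ℂ), IsFreeSolution a E (ι u₁) (ι u₂) →
      IsDiracSolution a m S E (ι (T₁ u₁)) (ι (T₂ u₂)) := fun u₁ u₂ hu =>
    hu.isDiracSolution ha hp hpS hSp hSm (continuous_toLine ha u₁) (continuous_toLine ha u₂)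
      (hι₁ u₁) (hι₂ u₂)
  refine ⟨fun u₁ u₂ hu => ⟨hforward u₁ u₂ hu, hz₁ u₁, hz₂ u₂⟩, fun ψ₁ ψ₂ hψ => ?_⟩
  -- The free solution with the values of ψ at 0 has as image a Dirac solution with the same values,
  -- hence ψ itself; so it is the preimage sought.
  obtain ⟨w₁, w₂, hw, hw₁, hw₂⟩ := exists_isFreeSolution ha E (ι ψ₁ 0) (ι ψ₂ 0)
  obtain ⟨e₁, e₂⟩ := (hforward w₁ w₂ hw).unique ha hp hpS hψ ((hz₁ w₁).trans hw₁)
    ((hz₂ w₂).trans hw₂)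
  have e {u v : C(Icc (-a) a, ℂ)} (huv : EqOn (ι u) (ι v) (Icc (-a) a)) : u = v := by
    ext x
    rw [← toLine_apply ha u x.2, ← toLine_apply ha v x.2]
    exact huv x.2
  rw [← e e₁, ← e e₂, T₁.symm_apply_apply, T₂.symm_apply_apply]
  exact ⟨hw, (hz₁ w₁).symm, (hz₂ w₂).symm⟩
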